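/- **Setting.** Let $m_Z>m_W>0$, $m_H>0$, $m_e>0$, $m_\nu\ge 0$, $\cos\Theta=m_W/m_Z$, $\sin\Theta=\sqrt{1-\cos^2\Theta}$, and let $l\neq0$ be a lightlike string direction. The bosons are $A_1=W_1$, $A_2=W_2$, $A_3=Z$ (masses $m_W,m_W,m_Z$), the photon $A_4=A$, all string-local potentials $A_a^\mu(x,l)$ built on the field strengths $F_a$, with escort fields $\phi_a(x,l)$ for $a=1,2,3$, forms $w_a=d_l\phi_a$ (so $d_lA_a^\mu=\partial^\mu w_a$, also for the photon), and a pointlike higgs $\phi_4$; $X_\pm=(X_1\mp iX_2)/\sqrt2$, $X_Z=X_3$. The leptons $e,\nu$ are Dirac fields. Up to an overall constant $g$, the boson–lepton coupling is $$S_1^F=b_1W_{-\mu}\bar e\gamma^\mu\nu+\tilde b_1W_{-\mu}\bar e\gamma^\mu\gamma^5\nu+b_2W_{+\mu}\bar\nu\gamma^\mu e+\tilde b_2W_{+\mu}\bar\nu\gamma^\mu\gamma^5e+Z_\mu(b_3\bar e\gamma^\mu e+\tilde b_3\bar e\gamma^\mu\gamma^5e+b_4\bar\nu\gamma^\mu\nu+\tilde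 b_4\bar\nu\gamma^\mu\gamma^5\nu)+A_\mu(b_5\bar e\gamma^\mu e+\tilde b_5\bar e\gamma^\mu\gamma^5e)$$ $$+\phi_-(c_1\bar e\nu+\tilde c_1\bar e\gamma^5\nu)+\phi_+(c_2\bar\nu e+\tilde c_2\bar\nu\gamma^5e)+\phi_Z(c_3\bar ee+\tilde c_3\bar e\gamma^5e+c_4\bar\nu\nu+\tilde c_4\bar\nu\gamma^5\nu)+\phi_4(c_0\bar ee+\tilde c_0\bar e\gamma^5e+c_5\bar\nu\nu+\tilde c_5\bar\nu\gamma^5\nu),$$ Hermitian, with $b_1,\tilde b_1$ real. Assume first-order string independence, $d_lS_1^F=\partial_\mu Q^\mu$ for a vector field $Q^\mu$ which is a linear combination of Wick products $w_a\,\bar\sigma\,\Gamma^\mu\tau$ of a form $w_a$ and two leptons $\sigma,\tau\in\{e,\nu\}$ with constant matrices $\Gamma^\mu$. Let $Q_1^F$ be the vector part of $S_1^F$ with $A_{a\mu}$ replaced by $w_a$, and let $$Q_{1\mu}^B=2\sum f_{abc}F_{a\mu\lambda}A_c^\lambda w_b+\sum\nolimits' f_{abc}(m_a^2+m_c^2-m_b^2)(A_{a\mu}-\partial_\mu\phi_a)\phi_cw_b+\frac{m_Z}{2\cos\Theta}\bigl(\phi_4(\partial_\mu\phi_Z-Z_\mu)-\partial_\mu\phi_4\,\phi_Z\bigr)w_Z,$$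 where $f_{abc}$ is completely skewsymmetric with $f_{123}=\frac12\cos\Theta$, $f_{124}=\frac12\sin\Theta$, $f_{134}=f_{234}=0$, and $a,c\in\{1,2,3\}$ in $\sum'$. The crossing of a summand of $Q_1=Q_1^B+Q_1^F$ at $x$ with a summand of $S_1^F$ at $x'$ is its contribution to $$\sum_{\varphi,\chi'}\frac{\partial Q_1^\mu}{\partial\varphi}\bigl(\langle \mathrm T\,\partial_\mu\varphi\,\chi'\rangle-\partial_\mu\langle \mathrm T\,\varphi\,\chi'\rangle\bigr)\frac{\partial S_1^{F\prime}}{\partial\chi'},$$ where divergences of free fields under $\mathrm T$ are reduced by the free field equations, and $\langle \mathrm T\varphi\chi'\rangle$ has momentum-space density $iM^{\varphi\chi}(p,l)/(p^2-m^2)$, $M^{\varphi\chi}$ being the sum over polarizations of products of intertwiners, except that numerical distributions with arbitrary momentum-space densities (at momenta with $p^2$ off all squared masses and $(pl)\ne0$) may be added to $\langle \mathrm T\,\partial_\lambda A_{a\mu}A'_{a\kappa}\rangle$. **Statement.** Suppose that $b_1,\tilde b_1$ do not both vanish and, in case $m_e=m_\nu$, that $\tilde b_3\ne0$. Suppose that,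 for some choice of the added distributions, the crossings with each of the following contents of uncontracted fields cancel (for all Dirac matrices between the spinors): $w_Z\phi_Z\,\bar f f$, $w_Z\phi_4\,\bar ff$, $w_-W_+\,\bar ff$ and $w_-F_+\,\bar ff$ for $f=e,\nu$, and $w_-\phi_Z\,\bar e\nu$. Then there is a sign $\varepsilon_1=\pm1$ with $$\tilde b_3=\frac{\varepsilon_1}{4\cos\Theta},\qquad \tilde b_1=\varepsilon_1b_1,\quad \tilde b_2=\varepsilon_1b_2,\qquad b_1^2=\tilde b_1^2=\tfrac18 .$$ Thus the interactions of the charged vector bosons with the fermions are fully chiral: they equal $b_1W_{-\mu}\bar e\gamma^\mu(1+\varepsilon_1\gamma^5)\nu+b_2W_{+\mu}\bar\nu\gamma^\mu(1+\varepsilon_1\gamma^5)e$. -/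

import Mathlib

/-!
# Tree-level string independence for the couplings of electroweak bosons to leptons

Conventions.  Lorentz indices are elements of `Fin 4`, the metric has signature `(+,-,-,-)`.
Vector bosons are numbered by `Fin 4`: `0, 1, 2, 3` stand for `W₁, W₂, Z` and the photon.
Leptons are numbered by `Fin 2`: `0` is the electron `e`, `1` is the neutrino `ν`.
The common factor `g` of all first-order vertices is stripped off.
-/

noncomputable section

namespace StringLocal

open Matrix

/-! ## Minkowski space and Dirac matrices -/

/-- Minkowski vectors, by contravariant components. -/
abbrev Vec := Fin 4 → ℝ

/-- Diagonal entries of the Minkowski metric. -/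
def eta (μ : Fin 4) : ℝ := if μ = 0 then 1 else -1

/-- The Minkowski product `(x y)`. -/
def mdot (x y : Vec) : ℝ := ∑ μ, eta μ * x μ * y μ

/-- Covariant components `x_μ`. -/
def low (x : Vec) (μ : Fin 4) : ℝ := eta μ * x μ

/-- Complex `4 × 4` matrices acting on Dirac spinors. -/
abbrev Spin := Matrix (Fin 4) (Fin 4) ℂ

/-- The Dirac matrices `γ^μ`, in the Dirac representation. -/
def gam : Fin 4 → Spin :=
  ![!![1, 0, 0, 0; 0, 1, 0, 0; 0, 0, -1, 0; 0, 0, 0, -1],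
    !![0, 0, 0, 1; 0, 0, 1, 0; 0, -1, 0, 0; -1, 0, 0, 0],
    !![0, 0, 0, -Complex.I; 0, 0, Complex.I, 0; 0, Complex.I, 0, 0; -Complex.I, 0, 0, 0],
    !![0, 0, 1, 0; 0, 0, 0, -1; -1, 0, 0, 0; 0, 1, 0, 0]]

/-- `γ⁵ = i γ⁰ γ¹ γ² γ³`. -/
def gam5 : Spin := Complex.I • (gam 0 * gam 1 * gam 2 * gam 3)

/-- `p̸ = p_μ γ^μ`. -/
def slash (p : Vec) : Spin := ∑ μ, ((low p μ : ℝ) : ℂ) • gam μ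

/-! ## The model: masses, Weinberg angle, structure constants -/

/-- Masses of the particles, with the string direction `l` and the tangent vector `dl` at `l`
on which the form-valued fields `w` are evaluated. -/
structure Model where
  mW : ℝ
  mZ : ℝ
  mH : ℝ
  mE : ℝ
  mN : ℝ
  l : Vec
  dl : Vec

/-- `0 < m_W < m_Z`; the electron and the higgs are massive; `l` is a nonzero lightlike vector
and `dl` is tangent to the light cone at `l`. -/
structure Model.Physical (K : Model) : Prop where
  mW_pos : 0 < K.mW
  mW_lt_mZ : K.mW < K.mZ
  mH_pos : 0 < K.mH
  mE_pos : 0 < K.mE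
  mN_nonneg : 0 ≤ K.mN
  l_ne : K.l ≠ 0
  l_null : mdot K.l K.l = 0
  dl_tangent : mdot K.l K.dl = 0

/-- Mass of the vector boson `A_a`; the photon is massless. -/
def Model.mB (K : Model) : Fin 4 → ℝ := ![K.mW, K.mW, K.mZ, 0]

/-- Mass of the lepton. -/
def Model.mF (K : Model) : Fin 2 → ℝ := ![K.mE, K.mN]

/-- Cosine of the Weinberg angle. -/
def Model.cosW (K : Model) : ℝ := K.mW / K.mZ

/-- Sine of the Weinberg angle. -/
def Model.sinW (K : Model) : ℝ := Real.sqrt (1 - K.cosW ^ 2)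

/-- The massive vector bosons. -/
def massive : Finset (Fin 4) := {0, 1, 2}

/-- The completely skewsymmetric symbol with value `1` at `(a,b,c) = (x,y,z)`
(for distinct `x, y, z`) that vanishes unless `{a,b,c} = {x,y,z}`. -/
def skew (x y z a b c : Fin 4) : ℝ :=
  Matrix.det (Matrix.of fun i j : Fin 3 => if ![a, b, c] i = ![x, y, z] j then (1 : ℝ) else 0)

/-- The structure constants: `f₁₂₃ = ½ cos Θ`, `f₁₂₄ = ½ sin Θ`, `f₁₃₄ = f₂₃₄ = 0`,
completely skewsymmetric. -/
def Model.f (K : Model) (a b c : Fin 4) : ℝ :=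
  1 / 2 * K.cosW * skew 0 1 2 a b c + 1 / 2 * K.sinW * skew 0 1 3 a b c

/-! ## Free boson fields and their time-ordered two-point functions -/

/-- Components of free boson fields at a point: the string-local potentials `A_{aμ}` (covariant
components), the escort fields `φ_a`, the form-valued fields `w_a = d_l φ_a`, the pointlike higgs
field `φ₄`, and the partial derivatives `∂_μ` of all these. -/
inductive Fld where
  | A (a : Fin 4) (μ : Fin 4)
  | esc (a : Fin 4)
  | w (a : Fin 4)
  | higgs
  | D (μ : Fin 4) (φ : Fld)

/-- The particle created by a field: a vector boson, or the higgs (`none`). -/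
def species : Fld → Option (Fin 4)
  | .A a _ => some a
  | .esc a => some a
  | .w a => some a
  | .higgs => none
  | .D _ φ => species φ

/-- Squared mass of a particle. -/
def Model.sqMass (K : Model) : Option (Fin 4) → ℝ
  | some a => K.mB a ^ 2
  | none => K.mH ^ 2

/-- The intertwiners `u_r(p,l)` of the boson fields (coefficients of the creation operators
`e^{i(px)} α_r†(p)`), as linear forms in the polarization vector `e_r^α(p)`:
`u_A^μ = e^μ - p^μ (e l)/(p l)`, `u_φ = i (e l)/(p l)`,
`u_w = i (e dl)/(p l) - i (p dl)(e l)/(p l)²`, and `∂_μ` multiplies by `i p_μ`.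
The only polarization state of the spinless higgs is encoded in the slot `α = 0`. -/
def Model.inter (K : Model) (p : Vec) : Fld → Fin 4 → ℂ
  | .A _ μ, α => (((if μ = α then eta μ else 0) - low p μ * low K.l α / mdot p K.l : ℝ) : ℂ)
  | .esc _, α => Complex.I * ((low K.l α / mdot p K.l : ℝ) : ℂ)
  | .w _, α => Complex.I *
      ((low K.dl α / mdot p K.l - mdot p K.dl * low K.l α / mdot p K.l ^ 2 : ℝ) : ℂ)
  | .higgs, α => if α = 0 then 1 else 0
  | .D μ φ, α => Complex.I * ((low p μ : ℝ) : ℂ) * K.inter p φ α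

/-- Polarization sums `∑_r e_r^α(p)^* e_r^β(p)`: `-g^{αβ} + p^α p^β / m²` for a massive vector
boson, `-g^{αβ}` (up to terms that the intertwiners annihilate) for the photon. -/
def Model.polSum (K : Model) (p : Vec) : Option (Fin 4) → Fin 4 → Fin 4 → ℂ
  | some a, α, β =>
      (((if α = β then -eta α else 0) +
        (if a = 3 then 0 else p α * p β / K.mB a ^ 2) : ℝ) : ℂ)
  | none, α, β => if α = 0 ∧ β = 0 then 1 else 0

/-- `M^{φχ}(p,l) = ∑_r u_r^{(φ)}(p,l)^* u_r^{(χ)}(p,l)`. -/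
def Model.M (K : Model) (p : Vec) (φ χ : Fld) : ℂ :=
  if species φ = species χ then
    ∑ α, ∑ β, star (K.inter p φ α) * K.polSum p (species φ) α β * K.inter p χ β
  else 0

/-- The time-ordered two-point function `⟨T₀ φ(x,l) χ(x',l)⟩`, given by its momentum-space
density: the coefficient of `(2π)⁻⁴ e^{-i(p(x-x'))} d⁴p`, at momenta `p` off the mass shell. -/
def Model.T0 (K : Model) (p : Vec) (φ χ : Fld) : ℂ :=
  Complex.I * K.M p φ χ / ((mdot p p - K.sqMass (species φ) : ℝ) : ℂ)

/-- A renormalization of the two-point functions `⟨T ∂_λ A_{aμ} A'_{aκ}⟩`: momentum-space densities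
`c a p λ μ κ` of arbitrary numerical distributions that are added to
`⟨T₀ ∂_λ A_{aμ} A'_{aκ}⟩`. -/
abbrev Renorm := Fin 4 → Vec → Fin 4 → Fin 4 → Fin 4 → ℂ

/-- The general time-ordered two-point functions `⟨T φ(x,l) χ(x',l)⟩`.  The only ones that enter
below and that are not unique are `⟨T ∂_λ A_{aμ} A'_{aκ}⟩`. -/
def Model.T (K : Model) (c : Renorm) (p : Vec) (φ χ : Fld) : ℂ :=
  K.T0 p φ χ +
    match φ, χ with
    | .D ρ (.A a μ), .A b κ => if a = b then c a p ρ μ κ else 0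
    | _, _ => 0

/-- The symbol of the derivative `∂_μ` acting on functions of `x` with kernel `e^{-i(px)}`. -/
def dsym (p : Vec) (μ : Fin 4) : ℂ := -Complex.I * ((low p μ : ℝ) : ℂ)

/-! ## Two-point obstructions

For a divergence `∂_μ C^μ` the field under the time-ordering is expressed through the free field
equations `∂_μ A_a^μ = -m_a² φ_a`, `□ φ_a = -m_a² φ_a`, `□ φ₄ = -m_H² φ₄`,
`∂^μ F_{aμλ} = -m_a² (A_{aλ} - ∂_λ φ_a)`. -/

/-- `O_μ(φ,χ') = ⟨T ∂_μ φ χ'⟩ - ∂_μ ⟨T φ χ'⟩`. -/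
def Model.obsMu (K : Model) (c : Renorm) (p : Vec) (μ : Fin 4) (φ χ : Fld) : ℂ :=
  K.T c p (.D μ φ) χ - dsym p μ * K.T c p φ χ

/-- `O(A_a,χ') = ⟨T ∂_μ A_a^μ χ'⟩ - ∂_μ ⟨T A_a^μ χ'⟩`. -/
def Model.obsA (K : Model) (c : Renorm) (p : Vec) (a : Fin 4) (χ : Fld) : ℂ :=
  -((K.mB a ^ 2 : ℝ) : ℂ) * K.T c p (.esc a) χ
    - ∑ μ, ((eta μ : ℝ) : ℂ) * dsym p μ * K.T c p (.A a μ) χ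

/-- `O(∂φ_a,χ') = ⟨T ∂_μ ∂^μ φ_a χ'⟩ - ∂_μ ⟨T ∂^μ φ_a χ'⟩`. -/
def Model.obsDEsc (K : Model) (c : Renorm) (p : Vec) (a : Fin 4) (χ : Fld) : ℂ :=
  -((K.mB a ^ 2 : ℝ) : ℂ) * K.T c p (.esc a) χ
    - ∑ μ, ((eta μ : ℝ) : ℂ) * dsym p μ * K.T c p (.D μ (.esc a)) χ

/-- `O(∂φ₄,χ')` for the higgs field `φ₄`. -/
def Model.obsDHiggs (K : Model) (c : Renorm) (p : Vec) (χ : Fld) : ℂ :=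
  -((K.mH ^ 2 : ℝ) : ℂ) * K.T c p .higgs χ
    - ∑ μ, ((eta μ : ℝ) : ℂ) * dsym p μ * K.T c p (.D μ .higgs) χ

/-- `O(F_{a•ρ},χ') = ⟨T ∂^μ F_{aμρ} χ'⟩ - ∂^μ ⟨T F_{aμρ} χ'⟩`,
with `F_{aμρ} = ∂_μ A_{aρ} - ∂_ρ A_{aμ}`. -/
def Model.obsF (K : Model) (c : Renorm) (p : Vec) (a ρ : Fin 4) (χ : Fld) : ℂ :=
  -((K.mB a ^ 2 : ℝ) : ℂ) * (K.T c p (.A a ρ) χ - K.T c p (.D ρ (.esc a)) χ)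
    - ∑ μ, ((eta μ : ℝ) : ℂ) * dsym p μ *
        (K.T c p (.D μ (.A a ρ)) χ - K.T c p (.D ρ (.A a μ)) χ)

/-- `⟨T₀ ψ(x) ψ̄(x')⟩` for a Dirac field of mass `m`: the density of `i S^F(x - x')`. -/
def fermT (m : ℝ) (p : Vec) : Spin :=
  (Complex.I / ((mdot p p - m ^ 2 : ℝ) : ℂ)) • (slash p + ((m : ℝ) : ℂ) • (1 : Spin))

/-- `O(γψ,ψ̄') = ⟨T₀ γ^μ ∂_μ ψ ψ̄'⟩ - γ^μ ∂_μ ⟨T₀ ψ ψ̄'⟩`, with the Dirac equation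
`γ^μ ∂_μ ψ = -i m ψ`. -/
def obsPsi (m : ℝ) (p : Vec) : Spin :=
  (-Complex.I * ((m : ℝ) : ℂ)) • fermT m p - ∑ μ, dsym p μ • (gam μ * fermT m p)

/-- `O(ψ',ψ̄γ) = ⟨T₀ ψ' ∂_μ ψ̄⟩ γ^μ - ∂_μ ⟨T₀ ψ' ψ̄⟩ γ^μ`, with the Dirac equation
`∂_μ ψ̄ γ^μ = i m ψ̄`.  As `ψ` sits at `x'` here, the density with respect to `e^{-i(p(x-x'))}`
of the two-point function is `fermT m (-p)`. -/
def obsPsiBar (m : ℝ) (p : Vec) : Spin :=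
  (Complex.I * ((m : ℝ) : ℂ)) • fermT m (-p) - ∑ μ, dsym p μ • (fermT m (-p) * gam μ)

/-! ## The couplings of bosons to leptons -/

/-- The coefficients of the general Ansatz for `S₁^F` (`bt`, `ct` are the coefficients with a
tilde, those of the terms with `γ⁵`). -/
structure Couplings where
  (b₁ bt₁ b₂ bt₂ b₃ bt₃ b₄ bt₄ b₅ bt₅ b₆ bt₆ : ℂ)
  (c₁ ct₁ c₂ ct₂ c₃ ct₃ c₄ ct₄ c₀ ct₀ c₅ ct₅ : ℂ)

/-- Hermiticity of `S₁^F`, absence of a coupling of the photon to the neutrino, and the choice of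
phases that makes `b₁` and `b̃₁` real. -/
structure Couplings.Admissible (C : Couplings) : Prop where
  b₁_real : star C.b₁ = C.b₁
  bt₁_real : star C.bt₁ = C.bt₁
  b₂_eq : C.b₂ = star C.b₁
  bt₂_eq : C.bt₂ = star C.bt₁
  b₃_real : star C.b₃ = C.b₃
  b₄_real : star C.b₄ = C.b₄
  b₅_real : star C.b₅ = C.b₅
  bt₃_real : star C.bt₃ = C.bt₃
  bt₄_real : star C.bt₄ = C.bt₄
  bt₅_real : star C.bt₅ = C.bt₅
  c₂_eq : C.c₂ = star C.c₁
  ct₂_eq : C.ct₂ = -star C.ct₁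
  c₃_real : star C.c₃ = C.c₃
  c₄_real : star C.c₄ = C.c₄
  c₀_real : star C.c₀ = C.c₀
  c₅_real : star C.c₅ = C.c₅
  ct₃_imag : star C.ct₃ = -C.ct₃
  ct₄_imag : star C.ct₄ = -C.ct₄
  ct₀_imag : star C.ct₀ = -C.ct₀
  ct₅_imag : star C.ct₅ = -C.ct₅
  b₆_zero : C.b₆ = 0
  bt₆_zero : C.bt₆ = 0

/-- `X₊ = (X₁ - i X₂)/√2`. -/
def plus (X : Fin 4 → ℂ) : ℂ := (X 0 - Complex.I * X 1) / ((Real.sqrt 2 : ℝ) : ℂ)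

/-- `X₋ = (X₁ + i X₂)/√2`. -/
def minus (X : Fin 4 → ℂ) : ℂ := (X 0 + Complex.I * X 1) / ((Real.sqrt 2 : ℝ) : ℂ)

/-- For values `X_a` of a boson multiplet, the total coefficient of `σ̄ γ^μ τ`. -/
def Couplings.vec (C : Couplings) (X : Fin 4 → ℂ) : Matrix (Fin 2) (Fin 2) ℂ :=
  !![C.b₃ * X 2 + C.b₅ * X 3, C.b₁ * minus X;
     C.b₂ * plus X, C.b₄ * X 2 + C.b₆ * X 3]

/-- For values `X_a` of a boson multiplet, the total coefficient of `σ̄ γ^μ γ⁵ τ`. -/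
def Couplings.axial (C : Couplings) (X : Fin 4 → ℂ) : Matrix (Fin 2) (Fin 2) ℂ :=
  !![C.bt₃ * X 2 + C.bt₅ * X 3, C.bt₁ * minus X;
     C.bt₂ * plus X, C.bt₄ * X 2 + C.bt₆ * X 3]

/-- For values `φ_a` of the escort fields and `h` of the higgs field, the total coefficient
of `σ̄ τ`.  (The photon has no escort field: `φ 3` is not used.) -/
def Couplings.scalar (C : Couplings) (φ : Fin 4 → ℂ) (h : ℂ) : Matrix (Fin 2) (Fin 2) ℂ :=
  !![C.c₃ * φ 2 + C.c₀ * h, C.c₁ * minus φ;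
     C.c₂ * plus φ, C.c₄ * φ 2 + C.c₅ * h]

/-- The total coefficient of `σ̄ γ⁵ τ`. -/
def Couplings.pseudo (C : Couplings) (φ : Fin 4 → ℂ) (h : ℂ) : Matrix (Fin 2) (Fin 2) ℂ :=
  !![C.ct₃ * φ 2 + C.ct₀ * h, C.ct₁ * minus φ;
     C.ct₂ * plus φ, C.ct₄ * φ 2 + C.ct₅ * h]

/-- The vertex `S₁^F = ∑_{σ,τ} σ̄ (S1F σ τ) τ`, a linear function of the values of the boson
fields `A_{aμ}`, `φ_a`, `φ₄`. -/
def Couplings.S1F (C : Couplings) (A : Fin 4 → Fin 4 → ℂ) (φ : Fin 4 → ℂ) (h : ℂ)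
    (σ τ : Fin 2) : Spin :=
  ∑ μ, (C.vec (fun a => A a μ) σ τ • gam μ + C.axial (fun a => A a μ) σ τ • (gam μ * gam5))
    + C.scalar φ h σ τ • (1 : Spin) + C.pseudo φ h σ τ • gam5

/-- `Q₁^{Fμ} = ∑_{σ,τ} σ̄ (Q1F w μ σ τ) τ`: the vector vertices with `A_{aμ}` replaced by `w_a`. -/
def Couplings.Q1F (C : Couplings) (w : Fin 4 → ℂ) (μ : Fin 4) (σ τ : Fin 2) : Spin :=
  C.vec w σ τ • gam μ + C.axial w σ τ • (gam μ * gam5)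

/-- The factor `K` in `Q₁^{Fμ} = γ^μ K`. -/
def Couplings.facR (C : Couplings) (w : Fin 4 → ℂ) (σ τ : Fin 2) : Spin :=
  C.vec w σ τ • (1 : Spin) + C.axial w σ τ • gam5

/-- The factor `K` in `Q₁^{Fμ} = K γ^μ`. -/
def Couplings.facL (C : Couplings) (w : Fin 4 → ℂ) (σ τ : Fin 2) : Spin :=
  C.vec w σ τ • (1 : Spin) - C.axial w σ τ • gam5

theorem gam5_eq : gam5 = !![0, 0, 1, 0; 0, 0, 0, 1; 1, 0, 0, 0; 0, 1, 0, 0] := by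
  simp [gam5, gam]

theorem gam_mul_gam5 (μ : Fin 4) : gam μ * gam5 = -(gam5 * gam μ) := by
  rw [gam5_eq]
  fin_cases μ <;> simp [gam]

theorem Couplings.Q1F_eq_facR (C : Couplings) (w : Fin 4 → ℂ) (μ : Fin 4) (σ τ : Fin 2) :
    C.Q1F w μ σ τ = gam μ * C.facR w σ τ := by
  simp [Couplings.Q1F, Couplings.facR, mul_add]

theorem Couplings.Q1F_eq_facL (C : Couplings) (w : Fin 4 → ℂ) (μ : Fin 4) (σ τ : Fin 2) :
    C.Q1F w μ σ τ = C.facL w σ τ * gam μ := by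
  simp [Couplings.Q1F, Couplings.facL, sub_mul, gam_mul_gam5]
  rfl

/-! ## String independence at first order -/

/-- The requirement `d_l S₁^F = ∂_μ Q^μ` for a vector field
`Q^μ = ∑ w_a σ̄ (Γ a μ σ τ) τ` with constant matrices `Γ a μ σ τ`, as an identity of Wick polynomials in
the values `w`, `ψ`, `ψb` and the first derivatives `dw`, `dψ`, `dψb` of the form-valued and
of the Dirac fields, which are subject to the Dirac equations only.  Here `d_l A_{aμ} = ∂_μ w_a`,
`d_l φ_a = w_a`, and `d_l` annihilates the pointlike higgs and Dirac fields. -/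
def Couplings.FirstOrder (C : Couplings) (K : Model) : Prop :=
  ∃ Γ : Fin 4 → Fin 4 → Fin 2 → Fin 2 → Spin,
    ∀ (w : Fin 4 → ℂ) (dw : Fin 4 → Fin 4 → ℂ)
      (ψ ψb : Fin 2 → Fin 4 → ℂ) (dψ dψb : Fin 2 → Fin 4 → Fin 4 → ℂ),
      (∀ τ, ∑ μ, gam μ *ᵥ dψ τ μ = (-Complex.I * ((K.mF τ : ℝ) : ℂ)) • ψ τ) →
      (∀ σ, ∑ μ, dψb σ μ ᵥ* gam μ = (Complex.I * ((K.mF σ : ℝ) : ℂ)) • ψb σ) →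
      ∑ σ, ∑ τ, ψb σ ⬝ᵥ (C.S1F dw w 0 σ τ *ᵥ ψ τ) =
        ∑ a, ∑ μ, ∑ σ, ∑ τ,
          (dw a μ * (ψb σ ⬝ᵥ (Γ a μ σ τ *ᵥ ψ τ))
            + w a * (dψb σ μ ⬝ᵥ (Γ a μ σ τ *ᵥ ψ τ))
            + w a * (ψb σ ⬝ᵥ (Γ a μ σ τ *ᵥ dψ τ μ)))

/-! ## String independence at second order, for tree graphs -/

/-- Values of the uncontracted fields of a Wick product, treated as independent (commuting)
symbols: the form-valued fields `w_a`, the potentials `A_{aμ}`, the field strengths `F_{aμν}`,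
the escort fields `φ_a` and their gradients, the higgs field and its gradient, and the Dirac
fields (covariant components throughout).  A content of a Wick product is selected by putting
all other fields equal to zero. -/
structure Legs where
  w : Fin 4 → ℂ := 0
  A : Fin 4 → Fin 4 → ℂ := 0
  F : Fin 4 → Fin 4 → Fin 4 → ℂ := 0
  φ : Fin 4 → ℂ := 0
  dφ : Fin 4 → Fin 4 → ℂ := 0
  h : ℂ := 0
  dh : Fin 4 → ℂ := 0
  ψ : Fin 2 → Fin 4 → ℂ := 0
  ψb : Fin 2 → Fin 4 → ℂ := 0

/-- Sum over all fields `φ` in the bosonic vector field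
`Q_{1μ}^B = 2 ∑ f_{abc} F_{aμρ} A_c^ρ w_b`
`+ ∑' f_{abc} (m_a² + m_c² - m_b²) (A_{aμ} - ∂_μ φ_a) φ_c w_b`
`+ (m_Z / 2 cos Θ) (φ₄ (∂_μ φ_Z - Z_μ) - ∂_μ φ₄ φ_Z) w_Z`
of the product of `∂Q_1^B/∂φ` with the two-point obstruction of `φ` and `χ'`. -/
def Model.bosonCrossing (K : Model) (c : Renorm) (p : Vec) (L : Legs) (χ : Fld) : ℂ :=
  (∑ a, ∑ b, ∑ d, 2 * ((K.f a b d : ℝ) : ℂ) *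
      (L.w b * ∑ ρ, ((eta ρ : ℝ) : ℂ) * L.A d ρ * K.obsF c p a ρ χ
        + ∑ μ, ∑ ρ, ((eta μ * eta ρ : ℝ) : ℂ) * L.F a μ ρ *
            (L.w b * K.obsMu c p μ (.A d ρ) χ + L.A d ρ * K.obsMu c p μ (.w b) χ)))
  + (∑ a ∈ massive, ∑ b, ∑ d ∈ massive,
      ((K.f a b d * (K.mB a ^ 2 + K.mB d ^ 2 - K.mB b ^ 2) : ℝ) : ℂ) *
      (L.φ d * L.w b * (K.obsA c p a χ - K.obsDEsc c p a χ)
        + ∑ μ, ((eta μ : ℝ) : ℂ) * (L.A a μ - L.dφ a μ) *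
            (L.w b * K.obsMu c p μ (.esc d) χ + L.φ d * K.obsMu c p μ (.w b) χ)))
  + ((K.mZ / (2 * K.cosW) : ℝ) : ℂ) *
      (L.w 2 * L.h * (K.obsDEsc c p 2 χ - K.obsA c p 2 χ)
        - L.w 2 * L.φ 2 * K.obsDHiggs c p χ
        + ∑ μ, ((eta μ : ℝ) : ℂ) *
            (L.w 2 * (L.dφ 2 μ - L.A 2 μ) * K.obsMu c p μ .higgs χ
              - L.w 2 * L.dh μ * K.obsMu c p μ (.esc 2) χ
              + (L.h * (L.dφ 2 μ - L.A 2 μ) - L.dh μ * L.φ 2) * K.obsMu c p μ (.w 2) χ))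

/-- The fermion matrix of the `(Q₁^B, S₁^F)`-type crossings:
`∑_{φ,χ'} ∂Q₁^B/∂φ · O(φ,χ') · ∂S₁^F'/∂χ'`. -/
def crossB (K : Model) (C : Couplings) (c : Renorm) (p : Vec) (L : Legs) (σ τ : Fin 2) : Spin :=
  C.S1F (fun a κ => K.bosonCrossing c p L (.A a κ)) (fun a => K.bosonCrossing c p L (.esc a))
    (K.bosonCrossing c p L .higgs) σ τ

/-- The fermion matrix of the `(Q₁^F, S₁^F)`-type crossings: contraction of the Dirac field of
`Q₁^F` with the conjugate Dirac field of `S₁^F'`, and the other way round. -/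
def crossF (K : Model) (C : Couplings) (p : Vec) (L : Legs) (σ τ : Fin 2) : Spin :=
  ∑ f, (C.facL L.w σ f * obsPsi (K.mF f) p * C.S1F L.A L.φ L.h f τ
    + C.S1F L.A L.φ L.h σ f * obsPsiBar (K.mF f) p * C.facR L.w f τ)

/-- The tree-graph obstruction to string independence at second order, in the sector with one
fermion pair: the momentum-space density at `p` (conjugate to `x - x'`) of the numerical
distributions `∑ ∂Q₁/∂φ · O(φ,χ') · ∂S₁^F'/∂χ'` as a function of the uncontracted fields.
The term with `x` and `x'` exchanged only doubles it, and is not written. -/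
def obstruction (K : Model) (C : Couplings) (c : Renorm) (p : Vec) (L : Legs) : ℂ :=
  ∑ σ, ∑ τ, L.ψb σ ⬝ᵥ ((crossB K C c p L σ τ + crossF K C p L σ τ) *ᵥ L.ψ τ)

/-- Momenta off all mass shells at which the string-local two-point functions are regular. -/
def Model.Generic (K : Model) (p : Vec) : Prop :=
  (∀ s, mdot p p ≠ K.sqMass s) ∧ (∀ f, mdot p p ≠ K.mF f ^ 2) ∧ mdot p K.l ≠ 0

/-- The crossings with the given content of uncontracted fields yield no obstruction. -/
def NoObstruction (K : Model) (C : Couplings) (c : Renorm) (L : Legs) : Prop :=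
  ∀ p, K.Generic p → obstruction K C c p L = 0

/-- The multiplet `X` with `X₋ = x` and `X₊ = X_Z = X_γ = 0`. -/
def ofMinus (x : ℂ) : Fin 4 → ℂ :=
  ![x / ((Real.sqrt 2 : ℝ) : ℂ), -Complex.I * x / ((Real.sqrt 2 : ℝ) : ℂ), 0, 0]

/-- The multiplet `X` with `X₊ = x` and `X₋ = X_Z = X_γ = 0`. -/
def ofPlus (x : ℂ) : Fin 4 → ℂ :=
  ![x / ((Real.sqrt 2 : ℝ) : ℂ), Complex.I * x / ((Real.sqrt 2 : ℝ) : ℂ), 0, 0]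

/-- The multiplet `X` with `X_Z = x` and all other components zero. -/
def ofZ (x : ℂ) : Fin 4 → ℂ := ![0, 0, x, 0]

/-- A single nonzero Dirac field: the lepton `τ` with spinor `s`. -/
def lepton (τ : Fin 2) (s : Fin 4 → ℂ) : Fin 2 → Fin 4 → ℂ := fun σ => if σ = τ then s else 0

/-- No obstruction from the contents `w_Z φ_Z f̄ f` and `w_Z φ_Z f̄ γ⁵ f`. -/
def CancelZEscort (K : Model) (C : Couplings) (c : Renorm) (f : Fin 2) : Prop :=
  ∀ (ω z : ℂ) (s t : Fin 4 → ℂ),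
    NoObstruction K C c { w := ofZ ω, φ := ofZ z, ψb := lepton f s, ψ := lepton f t }

/-- No obstruction from the contents `w_Z φ₄ f̄ f` and `w_Z φ₄ f̄ γ⁵ f`. -/
def CancelZHiggs (K : Model) (C : Couplings) (c : Renorm) (f : Fin 2) : Prop :=
  ∀ (ω h : ℂ) (s t : Fin 4 → ℂ),
    NoObstruction K C c { w := ofZ ω, h := h, ψb := lepton f s, ψ := lepton f t }

/-- No obstruction from the contents `w₋ W₊ f̄ f` and `w₋ F₊ f̄ f` (with any Dirac matrices between
the spinors), where `W₊` is transversal to the string and `F₊` is skewsymmetric. -/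
def CancelWW (K : Model) (C : Couplings) (c : Renorm) (f : Fin 2) : Prop :=
  ∀ (ω : ℂ) (W : Fin 4 → ℂ) (F : Fin 4 → Fin 4 → ℂ) (s t : Fin 4 → ℂ),
    ∑ μ, ((K.l μ : ℝ) : ℂ) * W μ = 0 → (∀ μ ν, F μ ν = -F ν μ) →
    NoObstruction K C c
      { w := ofMinus ω, A := fun a μ => ofPlus (W μ) a, F := fun a μ ν => ofPlus (F μ ν) a,
        ψb := lepton f s, ψ := lepton f t }

/-- No obstruction from the contents `w₋ φ_Z ē ν` and `w₋ φ_Z ē γ⁵ ν`. -/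
def CancelWEscort (K : Model) (C : Couplings) (c : Renorm) : Prop :=
  ∀ (ω z : ℂ) (s t : Fin 4 → ℂ),
    NoObstruction K C c { w := ofMinus ω, φ := ofZ z, ψb := lepton 0 s, ψ := lepton 1 t }

end StringLocal

end

noncomputable section

namespace StringLocal

open Matrix

/-! In momentum space each two-point obstruction needed is a propagator times its own wave operator.
The pole cancels, and a contact term remains. The spinor matrix of every listed content is therefore
an explicit combination of 1, γ⁵, γ^μ and γ^μγ⁵. Since the spinors are arbitrary, comparing
coefficients at one generic momentum gives algebraic relations between the couplings.

First order (`Couplings.FirstOrder.scalar_pseudo`): the Dirac equations turn the divergence of the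
currents into mass terms, so the escort couplings are mass differences times vector couplings and
mass sums times axial ones. The photon has no escort, hence no axial coupling to the electron.

Second order: put x = 4 cos Θ b̃₃ and y = 4 cos Θ b̃₄. Eliminating the higgs coupling from the two
w_Z contents gives m x(x² - 1) = 0 for the electron mass, and likewise for y with the neutrino mass.
The content w₋φ_Z gives b̃₁(m_e x + m_ν y) = (m_e - m_ν)b₁ and b₁(m_e x - m_ν y) = (m_e + m_ν)b̃₁.
These relations together exclude x = 0 (`axial_ne_zero`), so x = ±1.

Only now can the renormalization freedom be controlled. Since b̃₃ ≠ 0, the content w₋F₊ forces the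
added distribution of the Z to drop out of ⟨T F A'⟩ (`renorm_symm`). The content w₋W₊ then gives b̃₃
cos Θ = b₁b̃₂ + b̃₁b₂ and b̃₄ = -b̃₃, so y = -x. The second w₋φ_Z relation becomes b̃₁ = x b₁, and
the first w₋W₊ relation fixes b₁² = 1/8. -/

/-! ### Dirac algebra and the fermionic two-point obstructions -/

theorem gam5_mul_gam5 : gam5 * gam5 = 1 := by
  rw [gam5_eq]
  ext i j
  fin_cases i <;> fin_cases j <;> simp [Matrix.mul_apply, Fin.sum_univ_four]

/-- The matrices `γ^μ γ⁵`, `1`, `γ⁵` are linearly independent of each other and of the `γ^μ`. -/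
theorem coeff_eq_zero {v a : Fin 4 → ℂ} {s q : ℂ}
    (h : ∑ μ, (v μ • gam μ + a μ • (gam μ * gam5)) + s • (1 : Spin) + q • gam5 = 0) :
    a = 0 ∧ s = 0 ∧ q = 0 := by
  have e := fun i j => congrFun (congrFun h i) j
  rw [gam5_eq] at e
  -- The diagonal entries see only γ⁰, γ³γ⁵ and 1; the entries (0,2), (1,3), (2,0), (3,1) only γ³,
  -- γ⁰γ⁵ and γ⁵; the entries (0,1), (1,0) only γ¹γ⁵ and γ²γ⁵.
  have e00 := e 0 0
  have e11 := e 1 1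
  have e22 := e 2 2
  have e33 := e 3 3
  have e02 := e 0 2
  have e13 := e 1 3
  have e20 := e 2 0
  have e31 := e 3 1
  have e01 := e 0 1
  have e10 := e 1 0
  simp [gam, Fin.sum_univ_four] at e00 e11 e22 e33 e02 e13 e20 e31 e01 e10
  refine ⟨?_, ?_, ?_⟩
  · have hI : Complex.I * Complex.I = -1 := Complex.I_mul_I
    funext i
    fin_cases i
    · simp; linear_combination (e02 + e13 - e20 - e31) / 4
    · simp; linear_combination (e01 + e10) / 2
    · simp; linear_combination (Complex.I * e01 - Complex.I * e10) / 2 + (a 2) * hI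
    · simp; linear_combination (e00 - e11) / 2
  · linear_combination (e00 + e11 + e22 + e33) / 4
  · linear_combination (e02 + e13 + e20 + e31) / 4

theorem eta_mul_self (μ : Fin 4) : eta μ * eta μ = 1 := by
  unfold eta; split_ifs <;> norm_num

theorem slash_mul_slash (p : Vec) : slash p * slash p = ((mdot p p : ℝ) : ℂ) • (1 : Spin) := by
  have hI : Complex.I ^ 2 = -1 := Complex.I_sq
  ext i j
  fin_cases i <;> fin_cases j <;>
    simp [slash, gam, mdot, low, eta, Matrix.mul_apply, Fin.sum_univ_four] <;>
    first | ring1 | linear_combination (-(p 2 : ℂ) ^ 2) * hI | linear_combination ((p 2 : ℂ) ^ 2) * hI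

theorem slash_neg (p : Vec) : slash (-p) = -slash p := by
  simp [slash, low]

/-- The obstruction is i(p̸ - m) applied to i(p̸ + m)/(p² - m²), and p̸² = p² cancels the pole. -/
theorem obsPsi_eq {m : ℝ} {p : Vec} (h : mdot p p ≠ m ^ 2) : obsPsi m p = -1 := by
  have h0 : ((mdot p p - m ^ 2 : ℝ) : ℂ) ≠ 0 := by exact_mod_cast sub_ne_zero.2 h
  have e : ∑ μ, dsym p μ • (gam μ * fermT m p) = (-Complex.I) • (slash p * fermT m p) := by
    simp only [slash, Finset.sum_mul, Finset.smul_sum, dsym, smul_smul, smul_mul_assoc]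
  have e2 : slash p * fermT m p = (Complex.I / ((mdot p p - m ^ 2 : ℝ) : ℂ)) •
      (((mdot p p : ℝ) : ℂ) • (1 : Spin) + (m : ℂ) • slash p) := by
    simp [fermT, mul_add, slash_mul_slash]
  rw [obsPsi, e, e2, fermT]
  have : (-1 : Spin) = (Complex.I * Complex.I * ((mdot p p - m ^ 2 : ℝ) : ℂ) /
      ((mdot p p - m ^ 2 : ℝ) : ℂ)) • (1 : Spin) := by
    rw [mul_div_assoc, div_self h0]; simp
  rw [this]
  push_cast
  module

theorem obsPsiBar_eq {m : ℝ} {p : Vec} (h : mdot p p ≠ m ^ 2) : obsPsiBar m p = 1 := by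
  have h0 : ((mdot p p - m ^ 2 : ℝ) : ℂ) ≠ 0 := by exact_mod_cast sub_ne_zero.2 h
  have hp : mdot (-p) (-p) = mdot p p := by simp [mdot]
  have e : ∑ μ, dsym p μ • (fermT m (-p) * gam μ) = (-Complex.I) • (fermT m (-p) * slash p) := by
    simp only [slash, Finset.mul_sum, Finset.smul_sum, dsym, smul_smul, mul_smul_comm]
  have e2 : fermT m (-p) * slash p = (Complex.I / ((mdot p p - m ^ 2 : ℝ) : ℂ)) •
      (-((mdot p p : ℝ) : ℂ) • (1 : Spin) + (m : ℂ) • slash p) := by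
    simp [fermT, hp, slash_neg, add_mul, slash_mul_slash]
  rw [obsPsiBar, e, e2, fermT, hp, slash_neg]
  have : (1 : Spin) = (-(Complex.I * Complex.I) * ((mdot p p - m ^ 2 : ℝ) : ℂ) /
      ((mdot p p - m ^ 2 : ℝ) : ℂ)) • (1 : Spin) := by
    rw [mul_div_assoc, div_self h0]; simp
  nth_rewrite 3 [this]
  push_cast
  module

/-- A purely timelike momentum above all masses works: a nonzero lightlike `l` has `l 0 ≠ 0`, so
(pl) ≠ 0. -/
theorem Model.Physical.exists_generic {K : Model} (hK : K.Physical) : ∃ p, K.Generic p := by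
  have hl : K.l 0 ≠ 0 := by
    intro h0
    apply hK.l_ne
    have h := hK.l_null
    simp [mdot, eta, Fin.sum_univ_four, h0] at h
    funext i
    fin_cases i <;> simp
    · exact h0
    all_goals nlinarith [sq_nonneg (K.l 1), sq_nonneg (K.l 2), sq_nonneg (K.l 3)]
  have hfin : (Set.range K.sqMass ∪ Set.range (fun f => K.mF f ^ 2)).Finite :=
    (Set.finite_range _).union (Set.finite_range _)
  obtain ⟨B, hB⟩ := hfin.bddAbove
  set t : ℝ := |B| + 1
  have ht : B < t ^ 2 := by
    have h1 : 1 ≤ t := by simp [t]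
    have h2 : B < t := by have := le_abs_self B; simp only [t]; linarith
    nlinarith
  have ht0 : t ≠ 0 := by positivity
  have hp : mdot ![t, 0, 0, 0] ![t, 0, 0, 0] = t ^ 2 := by
    simp [mdot, eta, Fin.sum_univ_four]; ring
  refine ⟨![t, 0, 0, 0], fun s => ?_, fun f => ?_, ?_⟩
  · rw [hp]; exact (lt_of_le_of_lt (hB (Or.inl ⟨s, rfl⟩)) ht).ne'
  · rw [hp]; exact (lt_of_le_of_lt (hB (Or.inr ⟨f, rfl⟩)) ht).ne'
  · simp [mdot, eta, Fin.sum_univ_four, ht0, hl]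

/-! ### Bosonic two-point functions and their obstructions -/

theorem M_D (K : Model) (p : Vec) (μ : Fin 4) (φ χ : Fld) :
    K.M p (.D μ φ) χ = dsym p μ * K.M p φ χ := by
  simp only [Model.M, species, Model.inter, dsym]
  by_cases h : species φ = species χ
  · simp only [h, if_true, Finset.mul_sum, star_mul', Complex.star_def, Complex.conj_I,
      Complex.conj_ofReal, mul_assoc]
  · simp only [h, if_false, mul_zero]

/-- Since `T0` commutes with derivatives, an obstruction `obsMu` can only come from the added
distributions. -/
theorem T0_D (K : Model) (p : Vec) (μ : Fin 4) (φ χ : Fld) :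
    K.T0 p (.D μ φ) χ = dsym p μ * K.T0 p φ χ := by
  rw [Model.T0, Model.T0, M_D]
  simp only [species]
  ring

theorem T_A (K : Model) (c : Renorm) (p : Vec) (a μ : Fin 4) (χ : Fld) :
    K.T c p (.A a μ) χ = K.T0 p (.A a μ) χ := by simp [Model.T]

theorem T_esc (K : Model) (c : Renorm) (p : Vec) (a : Fin 4) (χ : Fld) :
    K.T c p (.esc a) χ = K.T0 p (.esc a) χ := by simp [Model.T]

theorem T_D_esc (K : Model) (c : Renorm) (p : Vec) (μ a : Fin 4) (χ : Fld) :
    K.T c p (.D μ (.esc a)) χ = dsym p μ * K.T0 p (.esc a) χ := by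
  simp [Model.T, T0_D]

theorem T_D_A (K : Model) (c : Renorm) (p : Vec) (μ a ρ b κ : Fin 4) :
    K.T c p (.D μ (.A a ρ)) (.A b κ) =
      dsym p μ * K.T0 p (.A a ρ) (.A b κ) + if a = b then c a p μ ρ κ else 0 := by
  simp [Model.T, T0_D]

theorem obsMu_A_A (K : Model) (c : Renorm) (p : Vec) (μ a ρ b κ : Fin 4) :
    K.obsMu c p μ (.A a ρ) (.A b κ) = if a = b then c a p μ ρ κ else 0 := by
  rw [Model.obsMu, T_D_A, T_A]; ring

theorem obsMu_esc (K : Model) (c : Renorm) (p : Vec) (μ a : Fin 4) (χ : Fld) :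
    K.obsMu c p μ (.esc a) χ = 0 := by
  rw [Model.obsMu, T_D_esc, T_esc]; ring

theorem obsMu_w (K : Model) (c : Renorm) (p : Vec) (μ a : Fin 4) (χ : Fld) :
    K.obsMu c p μ (.w a) χ = 0 := by
  simp [Model.obsMu, Model.T, T0_D]

theorem sum_eta_dsym_sq (p : Vec) :
    ∑ μ, ((eta μ : ℝ) : ℂ) * dsym p μ * dsym p μ = -((mdot p p : ℝ) : ℂ) := by
  simp [dsym, mdot, low, eta, Fin.sum_univ_four]
  linear_combination ((p 0:ℂ)^2 - (p 1:ℂ)^2 - (p 2:ℂ)^2 - (p 3:ℂ)^2) * Complex.I_sq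

theorem obsDHiggs_higgs {K : Model} {p : Vec} (hp : K.Generic p) (c : Renorm) :
    K.obsDHiggs c p .higgs = Complex.I := by
  have h0 : ((mdot p p - K.mH ^ 2 : ℝ) : ℂ) ≠ 0 := by
    exact_mod_cast sub_ne_zero.2 (hp.1 none)
  have h : K.T0 p .higgs .higgs = Complex.I / ((mdot p p - K.mH ^ 2 : ℝ) : ℂ) := by
    simp [Model.T0, Model.M, species, Model.inter, Model.polSum, Model.sqMass]
  have e : K.obsDHiggs c p .higgs = (-((K.mH ^ 2 : ℝ) : ℂ) -
      ∑ μ, ((eta μ : ℝ) : ℂ) * dsym p μ * dsym p μ) * K.T0 p .higgs .higgs := by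
    simp only [Model.obsDHiggs, Model.T, T0_D, add_zero]
    rw [sub_mul, Finset.sum_mul]
    simp only [mul_assoc]
  rw [e, sum_eta_dsym_sq, h]
  rw [mul_div_assoc', div_eq_iff h0]
  push_cast; ring

theorem obsDHiggs_esc (K : Model) (c : Renorm) (p : Vec) (a : Fin 4) :
    K.obsDHiggs c p (.esc a) = 0 := by
  simp [Model.obsDHiggs, Model.T, Model.T0, Model.M, species]

/-- The two-point function of the combination `A_{aρ} - ∂_ρ φ_a`. -/
theorem T0_A_sub {K : Model} {p : Vec} {a : Fin 4} (ha : a ≠ 3) (ρ : Fin 4) {χ : Fld}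
    (hχ : species χ = some a) :
    K.T0 p (.A a ρ) χ - dsym p ρ * K.T0 p (.esc a) χ =
      Complex.I / ((mdot p p - K.mB a ^ 2 : ℝ) : ℂ) * (-K.inter p χ ρ +
        ((low p ρ / K.mB a ^ 2 : ℝ) : ℂ) * ∑ β, ((p β : ℝ) : ℂ) * K.inter p χ β) := by
  have key : K.M p (.A a ρ) χ - dsym p ρ * K.M p (.esc a) χ = -K.inter p χ ρ +
        ((low p ρ / K.mB a ^ 2 : ℝ) : ℂ) * ∑ β, ((p β : ℝ) : ℂ) * K.inter p χ β := by
    -- The string-dependent terms cancel: A - ∂φ is the pointlike Proca field, whose intertwiner is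
    -- the polarization vector itself.
    have h1 : ∀ α, star (K.inter p (.A a ρ) α) - dsym p ρ * star (K.inter p (.esc a) α) =
        if ρ = α then ((eta ρ : ℝ) : ℂ) else 0 := by
      intro α
      simp only [Model.inter, dsym, star_mul', Complex.star_def, Complex.conj_I,
        Complex.conj_ofReal]
      push_cast
      split_ifs <;> push_cast <;>
      linear_combination (-(low p ρ : ℂ) * (low K.l α / mdot p K.l : ℂ)) * Complex.I_sq
    have h2 : K.M p (.A a ρ) χ - dsym p ρ * K.M p (.esc a) χ =
        ∑ α, ∑ β, (star (K.inter p (.A a ρ) α) - dsym p ρ * star (K.inter p (.esc a) α)) *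
          K.polSum p (some a) α β * K.inter p χ β := by
      simp only [Model.M, species, hχ, if_true, Finset.mul_sum, ← Finset.sum_sub_distrib]
      refine Finset.sum_congr rfl fun α _ => Finset.sum_congr rfl fun β _ => ?_
      ring
    rw [h2]
    simp only [h1]
    rw [Finset.sum_eq_single ρ (fun b _ hb => by simp [hb.symm]) (by simp)]
    have he : ((eta ρ : ℝ) : ℂ) * ((eta ρ : ℝ) : ℂ) = 1 := by exact_mod_cast eta_mul_self ρ
    have h3 : -K.inter p χ ρ = ∑ β, if ρ = β then -K.inter p χ β else 0 := by simp
    rw [h3, Finset.mul_sum, ← Finset.sum_add_distrib]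
    refine Finset.sum_congr rfl fun β _ => ?_
    simp only [Model.polSum, ha, if_false, if_true, low]
    split_ifs with hb
    · subst hb; push_cast
      linear_combination (-K.inter p χ ρ) * he
    · push_cast; ring
  rw [← key]
  simp only [Model.T0, species, Model.sqMass]
  ring

/-- The string term of the intertwiner is tuned to annihilate longitudinal polarizations. The p p/m²
part of the polarization sum is thus invisible to the potential. -/
theorem sum_mul_inter_A {K : Model} {p : Vec} (hp : K.Generic p) (a κ : Fin 4) :
    ∑ β, ((p β : ℝ) : ℂ) * K.inter p (.A a κ) β = 0 := by
  simp only [Model.inter]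
  norm_cast
  have h : ∑ β, p β * ((if κ = β then eta κ else 0) - low p κ * low K.l β / mdot p K.l) =
      low p κ - low p κ * mdot p K.l / mdot p K.l := by
    simp only [mul_sub, Finset.sum_sub_distrib, mul_ite, mul_zero, Finset.sum_ite_eq,
      Finset.mem_univ, if_true]
    congr 1
    · rw [low, mul_comm]
    · rw [mdot, Finset.mul_sum, Finset.sum_div]
      refine Finset.sum_congr rfl fun β _ => ?_
      rw [low, low]; ring
  rw [h, mul_div_assoc, div_self hp.2.2]; simp

theorem sum_mul_inter_esc {K : Model} {p : Vec} (hp : K.Generic p) (a : Fin 4) :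
    ∑ β, ((p β : ℝ) : ℂ) * K.inter p (.esc a) β = Complex.I := by
  have h : ∑ β, p β * (low K.l β / mdot p K.l) = 1 := by
    rw [← div_self hp.2.2]
    nth_rewrite 2 [mdot]
    rw [Finset.sum_div]
    refine Finset.sum_congr rfl fun β _ => ?_
    rw [low]; ring
  have h' : (∑ β, ((p β : ℝ) : ℂ) * ((low K.l β / mdot p K.l : ℝ) : ℂ)) = 1 := by
    exact_mod_cast h
  calc _ = Complex.I * ∑ β, ((p β : ℝ) : ℂ) * ((low K.l β / mdot p K.l : ℝ) : ℂ) := by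
        rw [Finset.mul_sum]
        refine Finset.sum_congr rfl fun β _ => ?_
        rw [Model.inter]; ring
    _ = _ := by rw [h', mul_one]

theorem eta_mul_dsym (p : Vec) (μ : Fin 4) :
    ((eta μ : ℝ) : ℂ) * dsym p μ = -Complex.I * ((p μ : ℝ) : ℂ) := by
  have he : ((eta μ : ℝ) : ℂ) * ((eta μ : ℝ) : ℂ) = 1 := by exact_mod_cast eta_mul_self μ
  rw [dsym, low]; push_cast
  linear_combination (-Complex.I * (p μ : ℂ)) * he

/-- The longitudinal part of the two-point function of `A_a - ∂φ_a`. -/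
theorem sum_T0_A_sub {K : Model} {p : Vec} (hp : K.Generic p) {a : Fin 4} (ha : a ≠ 3)
    (hm : K.mB a ≠ 0) {χ : Fld} (hχ : species χ = some a) :
    ∑ μ, ((eta μ : ℝ) : ℂ) * dsym p μ *
      (K.T0 p (.A a μ) χ - dsym p μ * K.T0 p (.esc a) χ) =
      (∑ β, ((p β : ℝ) : ℂ) * K.inter p χ β) / ((K.mB a ^ 2 : ℝ) : ℂ) := by
  have h0 : ((mdot p p - K.mB a ^ 2 : ℝ) : ℂ) ≠ 0 := by
    exact_mod_cast sub_ne_zero.2 (hp.1 (some a))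
  have hm' : ((K.mB a : ℝ) : ℂ) ≠ 0 := by exact_mod_cast hm
  have hpp : ∑ μ, ((p μ : ℝ) : ℂ) * ((low p μ : ℝ) : ℂ) = ((mdot p p : ℝ) : ℂ) := by
    norm_cast
    refine Finset.sum_congr rfl fun β _ => ?_
    rw [low]; ring
  set S := ∑ β, ((p β : ℝ) : ℂ) * K.inter p χ β with hS
  have e : ∀ μ, ((eta μ : ℝ) : ℂ) * dsym p μ *
      (K.T0 p (.A a μ) χ - dsym p μ * K.T0 p (.esc a) χ) =
      1 / ((mdot p p - K.mB a ^ 2 : ℝ) : ℂ) * (-(((p μ : ℝ) : ℂ) * K.inter p χ μ)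
        + ((p μ : ℝ) : ℂ) * ((low p μ : ℝ) : ℂ) * (S / ((K.mB a ^ 2 : ℝ) : ℂ))) := by
    intro μ
    rw [T0_A_sub ha μ hχ, eta_mul_dsym, ← hS]
    push_cast
    linear_combination (-(p μ : ℂ) / ((mdot p p : ℂ) - (K.mB a : ℂ) ^ 2) *
      (-K.inter p χ μ + (low p μ : ℂ) / (K.mB a : ℂ) ^ 2 * S)) * Complex.I_sq
  simp only [e]
  rw [← Finset.mul_sum, Finset.sum_add_distrib, Finset.sum_neg_distrib, ← Finset.sum_mul, hpp,
    ← hS]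
  push_cast at h0 ⊢
  field_simp
  ring

/-- The mass terms of the two field equations cancel, leaving minus the divergence of the Proca
two-point function, a contact term by `sum_T0_A_sub`. -/
theorem obsA_sub_obsDEsc {K : Model} {p : Vec} (hp : K.Generic p) (c : Renorm) {a : Fin 4}
    (ha : a ≠ 3) (hm : K.mB a ≠ 0) :
    K.obsA c p a (.esc a) - K.obsDEsc c p a (.esc a) =
      -(Complex.I / ((K.mB a ^ 2 : ℝ) : ℂ)) := by
  rw [← sum_mul_inter_esc hp a, ← sum_T0_A_sub hp ha hm rfl, Model.obsA, Model.obsDEsc]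
  simp only [T_A, T_D_esc, mul_sub, Finset.sum_sub_distrib]
  ring

theorem obsA_eq_zero_of_ne {K : Model} (c : Renorm) (p : Vec) {a b : Fin 4} (h : a ≠ b) :
    K.obsA c p a (.esc b) = 0 := by
  simp [Model.obsA, Model.T, Model.T0, Model.M, species, h]

theorem obsDEsc_eq_zero_of_ne {K : Model} (c : Renorm) (p : Vec) {a b : Fin 4} (h : a ≠ b) :
    K.obsDEsc c p a (.esc b) = 0 := by
  simp [Model.obsDEsc, Model.T, Model.T0, Model.M, species, h]

theorem obsA_higgs (K : Model) (c : Renorm) (p : Vec) (a : Fin 4) :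
    K.obsA c p a .higgs = 0 := by
  simp [Model.obsA, Model.T, Model.T0, Model.M, species]

theorem obsDEsc_higgs (K : Model) (c : Renorm) (p : Vec) (a : Fin 4) :
    K.obsDEsc c p a .higgs = 0 := by
  simp [Model.obsDEsc, Model.T, Model.T0, Model.M, species]

theorem obsF_eq_zero_of_ne {K : Model} (c : Renorm) (p : Vec) {a b : Fin 4} (ρ κ : Fin 4)
    (h : a ≠ b) : K.obsF c p a ρ (.A b κ) = 0 := by
  simp [Model.obsF, Model.T, Model.T0, Model.M, species, h]

/-- If the added distribution does not affect `⟨T F_{aμρ} A'_{aκ}⟩`, then `O(F_{a•ρ}, A'_{aκ})` is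
`i` times `-(g_{ρκ} - l_ρ p_κ / (pl))`. -/
theorem obsF_A {K : Model} {p : Vec} (hp : K.Generic p) {c : Renorm} {a : Fin 4}
    (ha : a ≠ 3) (hm : K.mB a ≠ 0) (ρ κ : Fin 4)
    (hc : ∀ μ ρ κ, c a p μ ρ κ = c a p ρ μ κ) :
    K.obsF c p a ρ (.A a κ) = -Complex.I * K.inter p (.A a κ) ρ := by
  have h0 : ((mdot p p - K.mB a ^ 2 : ℝ) : ℂ) ≠ 0 := by
    exact_mod_cast sub_ne_zero.2 (hp.1 (some a))
  have hl := sum_T0_A_sub hp ha hm (χ := .A a κ) rfl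
  rw [sum_mul_inter_A hp, zero_div] at hl
  have e := T0_A_sub (K := K) (p := p) ha ρ (χ := .A a κ) rfl
  rw [sum_mul_inter_A hp, mul_zero, add_zero] at e
  -- A symmetric added distribution drops out of the curl, and so does the gradient of φ. F may be
  -- taken as the curl of the Proca field, whose divergence term vanishes by `hl`.
  have hF : ∀ μ, ((eta μ : ℝ) : ℂ) * dsym p μ * (K.T c p (.D μ (.A a ρ)) (.A a κ)
      - K.T c p (.D ρ (.A a μ)) (.A a κ)) =
      ((eta μ : ℝ) : ℂ) * dsym p μ * dsym p μ *
        (K.T0 p (.A a ρ) (.A a κ) - dsym p ρ * K.T0 p (.esc a) (.A a κ))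
      - dsym p ρ * (((eta μ : ℝ) : ℂ) * dsym p μ *
        (K.T0 p (.A a μ) (.A a κ) - dsym p μ * K.T0 p (.esc a) (.A a κ))) := by
    intro μ
    rw [T_D_A, T_D_A, if_pos rfl, if_pos rfl, hc μ ρ κ]; ring
  rw [Model.obsF]
  simp only [hF]
  rw [Finset.sum_sub_distrib, ← Finset.sum_mul, ← Finset.mul_sum, hl, sum_eta_dsym_sq, T_A,
    T_D_esc, e]
  push_cast at h0 ⊢
  field_simp
  ring

/-! ### Multiplication of vertices by chiral factors, and testing with spinors -/

/-- The matrix `∑ (V_μ γ^μ + A_μ γ^μ γ⁵) + s + q γ⁵`. -/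
def vertex (V A : Fin 4 → ℂ) (s q : ℂ) : Spin :=
  ∑ μ, (V μ • gam μ + A μ • (gam μ * gam5)) + s • (1 : Spin) + q • gam5

theorem vertex_add (V A V' A' : Fin 4 → ℂ) (s q s' q' : ℂ) :
    vertex V A s q + vertex V' A' s' q' = vertex (V + V') (A + A') (s + s') (q + q') := by
  simp only [vertex, Pi.add_apply, add_smul, Finset.sum_add_distrib]
  abel

theorem vertex_neg (V A : Fin 4 → ℂ) (s q : ℂ) :
    -vertex V A s q = vertex (-V) (-A) (-s) (-q) := by
  simp only [vertex, Pi.neg_apply, neg_smul, Finset.sum_add_distrib, Finset.sum_neg_distrib]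
  abel

/-- As γ⁵ anticommutes with γ^μ, the products with `facL` on the left and `facR` on the right differ
only in the signs of a·s and a·q. For equal coefficients, their difference retains just 2aq and 2as.
-/
theorem mul_vertex (v a : ℂ) (V A : Fin 4 → ℂ) (s q : ℂ) :
    (v • (1 : Spin) - a • gam5) * vertex V A s q =
      vertex (v • V + a • A) (v • A + a • V) (v * s - a * q) (v * q - a * s) := by
  have h1 : ∀ μ, gam5 * gam μ = -(gam μ * gam5) := fun μ => by rw [gam_mul_gam5, neg_neg]
  have h2 : ∀ μ, gam5 * (gam μ * gam5) = -gam μ := fun μ => by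
    rw [← mul_assoc, h1, neg_mul, mul_assoc, gam5_mul_gam5, mul_one]
  simp only [vertex, mul_add, Finset.mul_sum, sub_mul, smul_mul_smul_comm, one_mul, mul_one,
    gam5_mul_gam5, h1, h2, Finset.sum_add_distrib, Finset.sum_sub_distrib, Pi.add_apply,
    Pi.smul_apply, smul_eq_mul, add_smul, sub_smul, smul_neg, Finset.sum_neg_distrib]
  abel

theorem vertex_mul (v a : ℂ) (V A : Fin 4 → ℂ) (s q : ℂ) :
    vertex V A s q * (v • (1 : Spin) + a • gam5) =
      vertex (v • V + a • A) (v • A + a • V) (v * s + a * q) (v * q + a * s) := by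
  simp only [vertex, add_mul, mul_add, Finset.sum_mul, smul_mul_smul_comm, one_mul, mul_one,
    gam5_mul_gam5, mul_assoc, Finset.sum_add_distrib, Pi.add_apply,
    Pi.smul_apply, smul_eq_mul, add_smul]
  simp only [mul_comm v, mul_comm a]
  abel

theorem S1F_eq_vertex (C : Couplings) (A : Fin 4 → Fin 4 → ℂ) (φ : Fin 4 → ℂ) (h : ℂ)
    (σ τ : Fin 2) : C.S1F A φ h σ τ =
      vertex (fun μ => C.vec (fun a => A a μ) σ τ) (fun μ => C.axial (fun a => A a μ) σ τ)
        (C.scalar φ h σ τ) (C.pseudo φ h σ τ) := rfl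

theorem sum_lepton (N : Fin 2 → Fin 2 → Spin) (f g : Fin 2) (s t : Fin 4 → ℂ) :
    ∑ σ, ∑ τ, lepton f s σ ⬝ᵥ (N σ τ *ᵥ lepton g t τ) = s ⬝ᵥ (N f g *ᵥ t) := by
  fin_cases f <;> fin_cases g <;> simp [lepton, Fin.sum_univ_two]

theorem eq_of_forall_dotProduct {M N : Spin}
    (h : ∀ s t : Fin 4 → ℂ, s ⬝ᵥ (M *ᵥ t) = s ⬝ᵥ (N *ᵥ t)) : M = N := by
  ext i j
  simpa using h (Pi.single i 1) (Pi.single j 1)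

/-! ### First-order string independence -/

theorem gam_zero_mul_self : gam 0 * gam 0 = 1 := by
  ext i j
  fin_cases i <;> fin_cases j <;> simp [gam, Matrix.mul_apply, Fin.sum_univ_four]

/-- Terms with ∂w identify `Γ` with the current in `Q1F`; terms with w then express the scalar
vertices through the divergence of that current. The anticommuting γ⁵ turns the mass difference into
a mass sum. -/
theorem Couplings.FirstOrder.scalar_pseudo {C : Couplings} {K : Model} (h : C.FirstOrder K)
    (w : Fin 4 → ℂ) (σ τ : Fin 2) :
    C.scalar w 0 σ τ = Complex.I * ((K.mF σ : ℂ) - K.mF τ) * C.vec w σ τ ∧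
    C.pseudo w 0 σ τ = Complex.I * ((K.mF σ : ℂ) + K.mF τ) * C.axial w σ τ := by
  obtain ⟨Γ, h⟩ := h
  -- The Dirac equation constrains only ∑ γ^μ ∂_μψ, so all spatial derivatives may vanish and the
  -- time derivative is solved for with (γ⁰)² = 1.
  set dt : (Fin 4 → ℂ) → Fin 4 → Fin 4 → ℂ := fun t μ =>
    if μ = 0 then gam 0 *ᵥ ((-Complex.I * (K.mF τ : ℂ)) • t) else 0
  set ds : (Fin 4 → ℂ) → Fin 4 → Fin 4 → ℂ := fun s μ =>
    if μ = 0 then ((Complex.I * (K.mF σ : ℂ)) • s) ᵥ* gam 0 else 0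
  have hdt : ∀ t ρ, ∑ μ, gam μ *ᵥ lepton τ (dt t μ) ρ =
      (-Complex.I * ((K.mF ρ : ℝ) : ℂ)) • lepton τ t ρ := by
    intro t ρ
    by_cases hρ : ρ = τ
    · subst hρ
      simp [lepton, dt, Fin.sum_univ_four, gam_zero_mul_self]
    · simp [lepton, hρ]
  have hds : ∀ s ρ, ∑ μ, lepton σ (ds s μ) ρ ᵥ* gam μ =
      (Complex.I * ((K.mF ρ : ℝ) : ℂ)) • lepton σ s ρ := by
    intro s ρ
    by_cases hρ : ρ = σ
    · subst hρ
      simp [lepton, ds, Fin.sum_univ_four, gam_zero_mul_self]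
    · simp [lepton, hρ]
  have h' := fun w dw s t => h w dw (lepton τ t) (lepton σ s) (fun ρ μ => lepton τ (dt t μ) ρ)
    (fun ρ μ => lepton σ (ds s μ) ρ) (hdt t) (hds s)
  simp only [Finset.sum_add_distrib, ← Finset.mul_sum, sum_lepton] at h'
  have hΓ : ∀ μ, ∑ a, w a • Γ a μ σ τ = C.Q1F w μ σ τ := by
    intro μ
    refine eq_of_forall_dotProduct fun s t => ?_
    have e := h' 0 (fun a ν => if ν = μ then w a else 0) s t
    have e1 : C.S1F (fun a ν => if ν = μ then w a else 0) 0 0 σ τ = C.Q1F w μ σ τ := by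
      have v0 : ∀ X : Fin 4 → ℂ, X = 0 → C.vec X σ τ = 0 ∧ C.axial X σ τ = 0 := by
        rintro X rfl
        fin_cases σ <;> fin_cases τ <;> simp [Couplings.vec, Couplings.axial, plus, minus]
      have s0 : C.scalar 0 0 σ τ = 0 ∧ C.pseudo 0 0 σ τ = 0 := by
        fin_cases σ <;> fin_cases τ <;> simp [Couplings.scalar, Couplings.pseudo, plus, minus]
      rw [Couplings.S1F, s0.1, s0.2, Finset.sum_eq_single μ]
      · simp [Couplings.Q1F]
      · intro ν _ hν
        simp [hν, v0 (fun _ => 0) rfl]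
      · simp
    rw [e1] at e
    rw [e]
    simp [Matrix.sum_mulVec, Matrix.smul_mulVec, dotProduct_sum]
  have key : (C.scalar w 0 σ τ • (1 : Spin) + C.pseudo w 0 σ τ • gam5) =
      (Complex.I * (K.mF σ : ℂ)) • C.facR w σ τ - (Complex.I * (K.mF τ : ℂ)) • C.facL w σ τ := by
    refine eq_of_forall_dotProduct fun s t => ?_
    have e := h' w 0 s t
    have e1 : C.S1F 0 w 0 σ τ = C.scalar w 0 σ τ • (1 : Spin) + C.pseudo w 0 σ τ • gam5 := by
      have v0 : C.vec (fun _ => 0) σ τ = 0 ∧ C.axial (fun _ => 0) σ τ = 0 := by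
        fin_cases σ <;> fin_cases τ <;> simp [Couplings.vec, Couplings.axial, plus, minus]
      simp [Couplings.S1F, v0]
    have e2 : ∀ (u v : Fin 4 → Fin 4 → ℂ), ∑ a, ∑ μ, w a * (u μ ⬝ᵥ (Γ a μ σ τ *ᵥ v μ)) =
        ∑ μ, u μ ⬝ᵥ (C.Q1F w μ σ τ *ᵥ v μ) := by
      intro u v
      rw [Finset.sum_comm]
      refine Finset.sum_congr rfl fun μ _ => ?_
      rw [← hΓ]
      simp [Matrix.sum_mulVec, Matrix.smul_mulVec, dotProduct_sum]
    rw [e1] at e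
    rw [e]
    have e3 := e2 (ds s) (fun _ => t)
    have e4 := e2 (fun _ => s) (dt t)
    simp only [Pi.zero_apply, zero_mul, Finset.sum_const_zero, zero_add]
    simp only [Finset.mul_sum] at e3 e4 ⊢
    rw [e3, e4]
    have e5 : ∑ μ, ds s μ ⬝ᵥ (C.Q1F w μ σ τ *ᵥ t) =
        s ⬝ᵥ (((Complex.I * (K.mF σ : ℂ)) • C.facR w σ τ) *ᵥ t) := by
      rw [Finset.sum_eq_single 0 (fun μ _ hμ => by simp [ds, hμ]) (by simp)]
      simp only [ds, if_true, Couplings.Q1F_eq_facR]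
      rw [← dotProduct_mulVec, mulVec_mulVec, ← mul_assoc, gam_zero_mul_self, one_mul,
        smul_mulVec, smul_dotProduct, dotProduct_smul]
    have e6 : ∑ μ, s ⬝ᵥ (C.Q1F w μ σ τ *ᵥ dt t μ) =
        s ⬝ᵥ (((-Complex.I * (K.mF τ : ℂ)) • C.facL w σ τ) *ᵥ t) := by
      rw [Finset.sum_eq_single 0 (fun μ _ hμ => by simp [dt, hμ]) (by simp)]
      simp only [dt, if_true, Couplings.Q1F_eq_facL]
      rw [mulVec_mulVec, mul_assoc, gam_zero_mul_self, mul_one, smul_mulVec, mulVec_smul]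
    rw [e5, e6, ← dotProduct_add, ← add_mulVec]
    congr 2
    module
  have z : vertex 0 0 (C.scalar w 0 σ τ - Complex.I * ((K.mF σ : ℂ) - K.mF τ) * C.vec w σ τ)
      (C.pseudo w 0 σ τ - Complex.I * ((K.mF σ : ℂ) + K.mF τ) * C.axial w σ τ) = 0 := by
    have k := sub_eq_zero.2 key
    rw [← k, vertex, Couplings.facR, Couplings.facL]
    simp only [Pi.zero_apply, zero_smul, Finset.sum_const_zero, add_zero]
    module
  obtain ⟨-, z1, z2⟩ := coeff_eq_zero z
  exact ⟨sub_eq_zero.1 z1, sub_eq_zero.1 z2⟩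

/-- The scalar and pseudoscalar couplings of the escort fields, and the absence of an axial
coupling of the photon, as consequences of string independence at first order. -/
theorem Couplings.FirstOrder.couplings {C : Couplings} {K : Model} (h : C.FirstOrder K)
    (hE : K.mE ≠ 0) :
    C.c₁ = Complex.I * ((K.mE : ℂ) - K.mN) * C.b₁ ∧
    C.ct₁ = Complex.I * ((K.mE : ℂ) + K.mN) * C.bt₁ ∧
    C.c₃ = 0 ∧ C.ct₃ = Complex.I * (2 * K.mE) * C.bt₃ ∧
    C.c₄ = 0 ∧ C.ct₄ = Complex.I * (2 * K.mN) * C.bt₄ ∧ C.bt₅ = 0 := by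
  have h2 : ((Real.sqrt 2 : ℝ) : ℂ) ≠ 0 := by exact_mod_cast (Real.sqrt_pos.2 two_pos).ne'
  have hm := h.scalar_pseudo ![((Real.sqrt 2 : ℝ) : ℂ), 0, 0, 0] 0 1
  have e0 := h.scalar_pseudo (ofZ 1) 0 0
  have e1 := h.scalar_pseudo (ofZ 1) 1 1
  -- The photon direction has no scalar vertex, so this reads 0 = 2i m_e b̃₅.
  have e3 := h.scalar_pseudo ![0, 0, 0, 1] 0 0
  simp [Couplings.scalar, Couplings.pseudo, Couplings.vec, Couplings.axial, minus, Model.mF,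
    ofZ, h2] at hm e0 e1 e3
  refine ⟨hm.1, hm.2, e0.1, ?_, e1.1, ?_, ?_⟩
  · rw [e0.2]; ring
  · rw [e1.2]; ring
  · rcases e3 with e3 | e3
    · exact absurd (by linarith) hE
    · exact e3

/-! ### Explicit form of the crossings -/

/-- The fermionic obstructions are ±1, so the fermionic crossing is a commutator-like difference of
products in flavour and spinor space. -/
theorem crossF_eq {K : Model} {p : Vec} (hp : K.Generic p) (C : Couplings) (L : Legs)
    (σ τ : Fin 2) : crossF K C p L σ τ =
      ∑ f, (C.S1F L.A L.φ L.h σ f * C.facR L.w f τ - C.facL L.w σ f * C.S1F L.A L.φ L.h f τ) := by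
  refine Finset.sum_congr rfl fun f _ => ?_
  rw [obsPsi_eq (hp.2.1 f), obsPsiBar_eq (hp.2.1 f)]
  simp only [mul_neg, mul_one, neg_mul]
  abel

theorem obstruction_lepton (K : Model) (C : Couplings) (c : Renorm) (p : Vec) (L : Legs)
    (f g : Fin 2) (s t : Fin 4 → ℂ) :
    obstruction K C c p { L with ψb := lepton f s, ψ := lepton g t } =
      s ⬝ᵥ ((crossB K C c p L f g + crossF K C p L f g) *ᵥ t) :=
  sum_lepton (fun σ τ => crossB K C c p L σ τ + crossF K C p L σ τ) f g s t

theorem cross_eq_zero {K : Model} {C : Couplings} {c : Renorm} {p : Vec} {L : Legs}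
    {f g : Fin 2}
    (h : ∀ s t, obstruction K C c p { L with ψb := lepton f s, ψ := lepton g t } = 0) :
    crossB K C c p L f g + crossF K C p L f g = 0 := by
  refine eq_of_forall_dotProduct fun s t => ?_
  rw [← obstruction_lepton, h, zero_mulVec, dotProduct_zero]

theorem sum_f_mul (K : Model) {T G : Fin 4 → Fin 4 → Fin 4 → ℂ}
    (h : ∀ a b d, T a b d = (K.f a b d : ℂ) * G a b d) :
    ∑ a, ∑ b, ∑ d, T a b d =
      (K.cosW : ℂ) / 2 * (G 0 1 2 + G 1 2 0 + G 2 0 1 - G 0 2 1 - G 1 0 2 - G 2 1 0)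
      + (K.sinW : ℂ) / 2 * (G 0 1 3 + G 1 3 0 + G 3 0 1 - G 0 3 1 - G 1 0 3 - G 3 1 0) := by
  simp [h, Fin.sum_univ_four, Model.f, skew, Matrix.det_fin_three]
  ring

/-- With both outer indices massive, f₁₂₄ contributes only when the form-valued field is that of the
photon. -/
theorem sum_massive_f_mul (K : Model) {T G : Fin 4 → Fin 4 → Fin 4 → ℂ}
    (h : ∀ a b d, T a b d = (K.f a b d : ℂ) * G a b d) :
    ∑ a ∈ massive, ∑ b, ∑ d ∈ massive, T a b d =
      (K.cosW : ℂ) / 2 * (G 0 1 2 + G 1 2 0 + G 2 0 1 - G 0 2 1 - G 1 0 2 - G 2 1 0)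
      + (K.sinW : ℂ) / 2 * (G 1 3 0 - G 0 3 1) := by
  simp [massive, h, Fin.sum_univ_four, Model.f, skew, Matrix.det_fin_three]
  ring

theorem bosonCrossing_Z (K : Model) (c : Renorm) (p : Vec) (ω z h : ℂ) (χ : Fld) :
    K.bosonCrossing c p { w := ofZ ω, φ := ofZ z, h := h } χ =
      ((K.mZ / (2 * K.cosW) : ℝ) : ℂ) *
        (ω * h * (K.obsDEsc c p 2 χ - K.obsA c p 2 χ) - ω * z * K.obsDHiggs c p χ) := by
  rw [Model.bosonCrossing, sum_massive_f_mul K fun a b d => by push_cast; rw [mul_assoc]]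
  simp [ofZ, obsMu_w]

/-- The mass factor m_W² + m_Z² - m_W² = m_Z² meets the contact term -i/m_W², and cos Θ · m_Z²/m_W²
= 1/cos Θ. -/
theorem bosonCrossing_Wescort {K : Model} (hK : K.Physical) {p : Vec} (hp : K.Generic p)
    (c : Renorm) (ω z : ℂ) :
    minus (fun a => K.bosonCrossing c p { w := ofMinus ω, φ := ofZ z } (.esc a)) =
      -(z * ω / (2 * K.cosW)) := by
  have hW : (K.mW : ℂ) ≠ 0 := by exact_mod_cast hK.mW_pos.ne'
  have hZ : (K.mZ : ℂ) ≠ 0 := by exact_mod_cast (hK.mW_pos.trans hK.mW_lt_mZ).ne'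
  have hs : ((Real.sqrt 2 : ℝ) : ℂ) ^ 2 = 2 := by
    exact_mod_cast Real.sq_sqrt (by norm_num : (0 : ℝ) ≤ 2)
  have h2 : ((Real.sqrt 2 : ℝ) : ℂ) ≠ 0 := by exact_mod_cast (Real.sqrt_pos.2 two_pos).ne'
  have hb0 : K.mB 0 = K.mW := rfl
  have hb1 : K.mB 1 = K.mW := rfl
  have hb2 : K.mB 2 = K.mZ := rfl
  have o0 := obsA_sub_obsDEsc hp c (a := 0) (by decide) (by rw [hb0]; exact hK.mW_pos.ne')
  have o1 := obsA_sub_obsDEsc hp c (a := 1) (by decide) (by rw [hb1]; exact hK.mW_pos.ne')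
  have n01 : ∀ a b : Fin 4, a ≠ b → K.obsA c p a (.esc b) - K.obsDEsc c p a (.esc b) = 0 :=
    fun a b h => by rw [obsA_eq_zero_of_ne c p h, obsDEsc_eq_zero_of_ne c p h, sub_zero]
  have e : ∀ χ, (K.obsDHiggs c p χ = 0) →
      K.bosonCrossing c p { w := ofMinus ω, φ := ofZ z } χ =
      K.cosW / 2 * (K.mZ ^ 2 * z) * (ofMinus ω 1 * (K.obsA c p 0 χ - K.obsDEsc c p 0 χ)
        - ofMinus ω 0 * (K.obsA c p 1 χ - K.obsDEsc c p 1 χ)) := by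
    intro χ hχ
    rw [Model.bosonCrossing, sum_massive_f_mul K fun a b d => by push_cast; rw [mul_assoc]]
    simp [ofZ, ofMinus, obsMu_w, hχ, hb0, hb1, hb2]
    ring
  rw [minus, e _ (obsDHiggs_esc K c p 0), e _ (obsDHiggs_esc K c p 1)]
  simp only [o0, o1, n01 0 1 (by decide), n01 1 0 (by decide),
    hb0, hb1, ofMinus, Model.cosW]
  push_cast
  simp
  field_simp
  linear_combination (z * ω : ℂ) * (2 * Complex.I_sq + hs)

/-- Contracting F_Z leaves a W leg and the obstruction `obsF`; contracting the potential Z leaves an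
F leg and only the added distribution, by `obsMu_A_A`. -/
theorem bosonCrossing_WW (K : Model) (c : Renorm) (p : Vec) (ω : ℂ) (W : Fin 4 → ℂ)
    (F : Fin 4 → Fin 4 → ℂ) (κ : Fin 4) :
    K.bosonCrossing c p { w := ofMinus ω, A := fun a μ => ofPlus (W μ) a,
                          F := fun a μ ν => ofPlus (F μ ν) a } (.A 2 κ) =
      Complex.I * K.cosW * ω * (∑ ρ, ((eta ρ : ℝ) : ℂ) * W ρ * K.obsF c p 2 ρ (.A 2 κ)
        - ∑ μ, ∑ ρ, ((eta μ * eta ρ : ℝ) : ℂ) * F μ ρ * c 2 p μ ρ κ) := by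
  have hs : (((Real.sqrt 2 : ℝ) : ℂ) ^ 2)⁻¹ = 1 / 2 := by
    have : ((Real.sqrt 2 : ℝ) : ℂ) ^ 2 = 2 := by
      exact_mod_cast Real.sq_sqrt (by norm_num : (0 : ℝ) ≤ 2)
    rw [this]; norm_num
  rw [Model.bosonCrossing, sum_massive_f_mul K fun a b d => by push_cast; rw [mul_assoc],
    sum_f_mul K fun a b d => by rw [mul_comm 2, mul_assoc]]
  simp only [obsMu_w, obsMu_esc, obsMu_A_A]
  simp [ofMinus, ofPlus, obsF_eq_zero_of_ne]
  set S := ∑ ρ, ((eta ρ : ℝ) : ℂ) * W ρ * K.obsF c p 2 ρ (.A 2 κ) with hS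
  set R := ∑ μ, ∑ ρ, ((eta μ : ℝ) : ℂ) * ((eta ρ : ℝ) : ℂ) * F μ ρ * c 2 p μ ρ κ with hR
  set r := ((Real.sqrt 2 : ℝ) : ℂ)
  have s1 : ∑ x, ((eta x : ℝ) : ℂ) * (Complex.I * W x / r) * K.obsF c p 2 x (.A 2 κ) =
      Complex.I / r * S := by
    rw [hS, Finset.mul_sum]
    exact Finset.sum_congr rfl fun _ _ => by ring
  have s2 : ∑ x, ((eta x : ℝ) : ℂ) * (W x / r) * K.obsF c p 2 x (.A 2 κ) = 1 / r * S := by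
    rw [hS, Finset.mul_sum]
    exact Finset.sum_congr rfl fun _ _ => by ring
  have r1 : ∑ x, ∑ y, ((eta x : ℝ) : ℂ) * ((eta y : ℝ) : ℂ) * (F x y / r) *
      (-(Complex.I * ω) / r * c 2 p x y κ) = -(Complex.I * ω) * (r ^ 2)⁻¹ * R := by
    simp only [hR, Finset.mul_sum]
    exact Finset.sum_congr rfl fun _ _ => Finset.sum_congr rfl fun _ _ => by ring
  have r2 : ∑ x, ∑ y, ((eta x : ℝ) : ℂ) * ((eta y : ℝ) : ℂ) * (Complex.I * F x y / r) *
      (ω / r * c 2 p x y κ) = Complex.I * ω * (r ^ 2)⁻¹ * R := by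
    simp only [hR, Finset.mul_sum]
    exact Finset.sum_congr rfl fun _ _ => Finset.sum_congr rfl fun _ _ => by ring
  rw [s1, s2, r1, r2]
  linear_combination (2 * (K.cosW : ℂ) * Complex.I * ω * (S - R)) * hs

/-! ### Relations between couplings from the cancellations -/

/-- The first relation is the coefficient of 1 for the escort leg, with higgs exchange on the
bosonic side. The second is the coefficient of γ⁵ for the higgs leg, with escort exchange. -/
theorem cancelZ_relations {K : Model} (hK : K.Physical) {C : Couplings} {c : Renorm}
    {p : Vec} (hp : K.Generic p) (f : Fin 2) {cs ct c0 ct0 bt : ℂ}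
    (hax : ∀ ω, C.axial (ofZ ω) f f = bt * ω)
    (hsc : ∀ φ h, C.scalar φ h f f = cs * φ 2 + c0 * h)
    (hps : ∀ φ h, C.pseudo φ h f f = ct * φ 2 + ct0 * h)
    (hcs : cs = 0) (h : CancelZEscort K C c f ∧ CancelZHiggs K C c f) :
    2 * bt * ct = Complex.I * (K.mZ / (2 * K.cosW)) * c0 ∧
    2 * bt * c0 = -(Complex.I / (2 * K.cosW * K.mZ)) * ct := by
  have hZ0 : K.mZ ≠ 0 := (hK.mW_pos.trans hK.mW_lt_mZ).ne'
  have hZ : (K.mZ : ℂ) ≠ 0 := by exact_mod_cast hZ0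
  have hW : (K.mW : ℂ) ≠ 0 := by exact_mod_cast hK.mW_pos.ne'
  have hc : (K.cosW : ℂ) ≠ 0 := by
    rw [Model.cosW]; push_cast; exact div_ne_zero hW hZ
  have o2 := obsA_sub_obsDEsc hp c (a := 2) (by decide) (by exact hZ0)
  have hb2 : K.mB 2 = K.mZ := rfl
  rw [hb2] at o2
  have gen : ∀ z h', crossB K C c p { w := ofZ 1, φ := ofZ z, h := h' } f f +
      crossF K C p { w := ofZ 1, φ := ofZ z, h := h' } f f = 0 →
      c0 * -(K.mZ / (2 * K.cosW) * z * Complex.I) + 2 * bt * (ct * z + ct0 * h') = 0 ∧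
      ct * (K.mZ / (2 * K.cosW) * h' * (Complex.I / K.mZ ^ 2)) +
        ct0 * -(K.mZ / (2 * K.cosW) * z * Complex.I) + 2 * bt * (c0 * h') = 0 := by
    intro z h' e
    have off : ∀ τ : Fin 2, τ ≠ f → C.facL (ofZ 1) f τ = 0 ∧ C.facR (ofZ 1) τ f = 0 := by
      intro τ hτ
      fin_cases f <;> fin_cases τ <;>
        simp_all [Couplings.facL, Couplings.facR, Couplings.vec, Couplings.axial, ofZ, minus, plus]
    rw [crossF_eq hp, Finset.sum_eq_single f (fun τ _ hτ => by simp [off τ hτ]) (by simp),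
      crossB] at e
    simp only [S1F_eq_vertex, Couplings.facL, Couplings.facR, mul_vertex, vertex_mul,
      sub_eq_add_neg (vertex _ _ _ _), vertex_neg, vertex_add] at e
    obtain ⟨-, e1, e2⟩ := coeff_eq_zero e
    simp only [bosonCrossing_Z, hsc, hps, hax, obsDHiggs_higgs hp, obsDHiggs_esc, obsA_higgs,
      obsDEsc_higgs, hcs] at e1 e2
    rw [← neg_sub (K.obsA c p 2 _), o2] at e1 e2
    simp only [ofZ] at e1 e2
    push_cast at e1 e2
    simp at e1 e2
    constructor
    · linear_combination e1
    · linear_combination e2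
  obtain ⟨g1, -⟩ := gen 1 0 (cross_eq_zero fun s t => h.1 1 1 s t p hp)
  -- The higgs content leaves φ at its default 0, while `gen` expects it in the form `ofZ z`.
  have hz : (ofZ 0 : Fin 4 → ℂ) = 0 := by ext i; fin_cases i <;> simp [ofZ]
  have h2 := cross_eq_zero (L := { w := ofZ 1, h := 1 }) fun s t => h.2 1 1 s t p hp
  rw [← hz] at h2
  obtain ⟨-, g2⟩ := gen 0 1 h2
  constructor
  · linear_combination g1
  · field_simp at g2 ⊢
    linear_combination g2

/-- The escort of the Z attaches to the electron or to the neutrino; the two graphs add in the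
coefficient of 1 and subtract in that of γ⁵. -/
theorem cancelWEscort_relations {K : Model} (hK : K.Physical) {C : Couplings} {c : Renorm}
    {p : Vec} (hp : K.Generic p) (h3 : C.c₃ = 0) (h4 : C.c₄ = 0) (h : CancelWEscort K C c) :
    C.bt₁ * (C.ct₃ + C.ct₄) = C.c₁ / (2 * K.cosW) ∧
    C.b₁ * (C.ct₃ - C.ct₄) = C.ct₁ / (2 * K.cosW) := by
  have hs : ((Real.sqrt 2 : ℝ) : ℂ) ^ 2 = 2 := by
    exact_mod_cast Real.sq_sqrt (by norm_num : (0 : ℝ) ≤ 2)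
  have h2 : ((Real.sqrt 2 : ℝ) : ℂ) ≠ 0 := by exact_mod_cast (Real.sqrt_pos.2 two_pos).ne'
  have hm : minus (ofMinus 1) = 1 := by
    simp [minus, ofMinus]
    field_simp
    rw [hs, Complex.I_sq]; norm_num
  have hpl : plus (ofMinus 1) = 0 := by
    simp [plus, ofMinus]
    field_simp
    rw [Complex.I_sq]; norm_num
  have e := cross_eq_zero (L := { w := ofMinus 1, φ := ofZ 1 }) fun s t => h 1 1 s t p hp
  rw [crossF_eq hp, Fin.sum_univ_two, crossB] at e
  have d1 : C.facR (ofMinus 1) 1 1 = 0 := by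
    simp [Couplings.facR, Couplings.vec, Couplings.axial, ofMinus]
  have d0 : C.facL (ofMinus 1) 0 0 = 0 := by
    simp [Couplings.facL, Couplings.vec, Couplings.axial, ofMinus]
  simp only [d0, d1, mul_zero, zero_mul, sub_zero, zero_sub] at e
  simp only [S1F_eq_vertex, Couplings.facL, Couplings.facR, mul_vertex, vertex_mul,
    vertex_neg, vertex_add] at e
  obtain ⟨-, e1, e2⟩ := coeff_eq_zero e
  simp [Couplings.scalar, Couplings.pseudo, Couplings.vec, Couplings.axial, hm, hpl,
    ofZ, h3, h4] at e1 e2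
  have hb := bosonCrossing_Wescort hK hp c 1 1
  simp only [ofZ] at hb
  constructor
  · linear_combination e1 - C.c₁ * hb
  · linear_combination e2 - C.ct₁ * hb

theorem cancelWW_axial {K : Model} {C : Couplings} {c : Renorm}
    {p : Vec} (hp : K.Generic p) (h5 : C.bt₅ = 0) (h6 : C.bt₆ = 0)
    (h : CancelWW K C c 0 ∧ CancelWW K C c 1)
    (W : Fin 4 → ℂ) (F : Fin 4 → Fin 4 → ℂ)
    (hW : ∑ μ, ((K.l μ : ℝ) : ℂ) * W μ = 0) (hF : ∀ μ ν, F μ ν = -F ν μ) (κ : Fin 4) :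
    C.bt₃ * (Complex.I * K.cosW * (∑ ρ, ((eta ρ : ℝ) : ℂ) * W ρ * K.obsF c p 2 ρ (.A 2 κ)
        - ∑ μ, ∑ ρ, ((eta μ * eta ρ : ℝ) : ℂ) * F μ ρ * c 2 p μ ρ κ)) =
      (C.b₁ * C.bt₂ + C.bt₁ * C.b₂) * W κ ∧
    C.bt₄ * (Complex.I * K.cosW * (∑ ρ, ((eta ρ : ℝ) : ℂ) * W ρ * K.obsF c p 2 ρ (.A 2 κ)
        - ∑ μ, ∑ ρ, ((eta μ * eta ρ : ℝ) : ℂ) * F μ ρ * c 2 p μ ρ κ)) =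
      -((C.b₁ * C.bt₂ + C.bt₁ * C.b₂) * W κ) := by
  have hs : ((Real.sqrt 2 : ℝ) : ℂ) ^ 2 = 2 := by
    exact_mod_cast Real.sq_sqrt (by norm_num : (0 : ℝ) ≤ 2)
  have h2 : ((Real.sqrt 2 : ℝ) : ℂ) ≠ 0 := by exact_mod_cast (Real.sqrt_pos.2 two_pos).ne'
  have hm : minus (ofMinus 1) = 1 := by
    simp [minus, ofMinus]
    field_simp
    rw [hs, Complex.I_sq]; norm_num
  have hpl : plus (ofMinus 1) = 0 := by
    simp [plus, ofMinus]
    field_simp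
    rw [Complex.I_sq]; norm_num
  have hpp : ∀ x, plus (ofPlus x) = x := by
    intro x
    simp [plus, ofPlus]
    field_simp
    rw [hs, Complex.I_sq]; ring
  have hmp : ∀ x, minus (ofPlus x) = 0 := by
    intro x
    simp [minus, ofPlus]
    field_simp
    rw [Complex.I_sq]; ring
  have e := cross_eq_zero (L := { w := ofMinus 1, A := fun a μ => ofPlus (W μ) a,
                                  F := fun a μ ν => ofPlus (F μ ν) a })
    fun s t => h.1 1 W F s t hW hF p hp
  have e' := cross_eq_zero (L := { w := ofMinus 1, A := fun a μ => ofPlus (W μ) a,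
                                   F := fun a μ ν => ofPlus (F μ ν) a })
    fun s t => h.2 1 W F s t hW hF p hp
  rw [crossF_eq hp, Fin.sum_univ_two, crossB] at e e'
  -- w₋ occurs only in the entry ēν. For the electron only the left product survives, for the
  -- neutrino only the right one, whence the opposite signs.
  have d : C.facR (ofMinus 1) 0 0 = 0 ∧ C.facR (ofMinus 1) 1 1 = 0 ∧
      C.facR (ofMinus 1) 1 0 = 0 := by
    refine ⟨?_, ?_, ?_⟩ <;> simp [Couplings.facR, Couplings.vec, Couplings.axial, hpl]
      <;> simp [ofMinus]
  have d' : C.facL (ofMinus 1) 0 0 = 0 ∧ C.facL (ofMinus 1) 1 1 = 0 ∧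
      C.facL (ofMinus 1) 1 0 = 0 := by
    refine ⟨?_, ?_, ?_⟩ <;> simp [Couplings.facL, Couplings.vec, Couplings.axial, hpl]
      <;> simp [ofMinus]
  simp only [d, d', mul_zero, zero_mul, sub_zero, zero_sub, zero_add, add_zero] at e e'
  simp only [S1F_eq_vertex, Couplings.facL, Couplings.facR, mul_vertex, vertex_mul,
    vertex_neg, vertex_add] at e e'
  obtain ⟨e, -, -⟩ := coeff_eq_zero e
  obtain ⟨e', -, -⟩ := coeff_eq_zero e'
  have e := congrFun e κ
  have e' := congrFun e' κ
  simp only [Pi.add_apply, Pi.neg_apply, Pi.smul_apply, bosonCrossing_WW, Couplings.vec,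
    Couplings.axial] at e e'
  simp [hm, hpp, h5, h6, -Complex.ofReal_mul] at e e'
  constructor
  · push_cast at e ⊢
    linear_combination e
  · push_cast at e' ⊢
    linear_combination e'

/-- A pure F leg has no fermionic crossing to compensate it. Testing with elementary skewsymmetric F
isolates the skewsymmetric part of the added distribution. -/
theorem renorm_symm {K : Model} {C : Couplings} {c : Renorm}
    {p : Vec} (hp : K.Generic p) (h5 : C.bt₅ = 0) (h6 : C.bt₆ = 0)
    (h : CancelWW K C c 0 ∧ CancelWW K C c 1) (hc : (K.cosW : ℂ) ≠ 0) (h3 : C.bt₃ ≠ 0)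
    (μ ρ κ : Fin 4) : c 2 p μ ρ κ = c 2 p ρ μ κ := by
  have e := (cancelWW_axial hp h5 h6 h 0
    (fun α β => (if α = μ ∧ β = ρ then 1 else 0) - (if α = ρ ∧ β = μ then 1 else 0))
    (by simp) (fun α β => by simp only [neg_sub, and_comm]) κ).1
  have hη : ∀ ν, ((eta ν : ℝ) : ℂ) ≠ 0 := fun ν => by
    unfold eta; split_ifs <;> norm_num
  have hsum : ∀ μ ρ : Fin 4, ∑ α, ∑ β, ((eta α * eta β : ℝ) : ℂ) *
      (if α = μ ∧ β = ρ then 1 else 0) * c 2 p α β κ = eta μ * eta ρ * c 2 p μ ρ κ := by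
    intro μ ρ
    simp [ite_and]
  simp only [mul_sub, sub_mul, Finset.sum_sub_distrib, hsum, Pi.zero_apply, mul_zero, zero_mul,
    Finset.sum_const_zero, zero_sub] at e
  have : (C.bt₃ * Complex.I * K.cosW * eta μ * eta ρ) * (c 2 p μ ρ κ - c 2 p ρ μ κ) = 0 := by
    linear_combination -e
  have hne : (C.bt₃ * Complex.I * K.cosW * eta μ * eta ρ) ≠ 0 := by
    simp [h3, hc, hη, Complex.I_ne_zero]
  exact sub_eq_zero.1 ((mul_eq_zero.1 this).resolve_left hne)

theorem cancelWW_relations {K : Model} (hK : K.Physical) {C : Couplings} {c : Renorm}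
    {p : Vec} (hp : K.Generic p) (h5 : C.bt₅ = 0) (h6 : C.bt₆ = 0)
    (h : CancelWW K C c 0 ∧ CancelWW K C c 1) (h3 : C.bt₃ ≠ 0) :
    C.bt₃ * K.cosW = C.b₁ * C.bt₂ + C.bt₁ * C.b₂ ∧ C.bt₄ = -C.bt₃ := by
  have hZ0 : K.mZ ≠ 0 := (hK.mW_pos.trans hK.mW_lt_mZ).ne'
  have hc : (K.cosW : ℂ) ≠ 0 := by
    exact_mod_cast div_ne_zero hK.mW_pos.ne' hZ0
  have hsymm := renorm_symm hp h5 h6 h hc h3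
  obtain ⟨W, κ, hW, hκ⟩ : ∃ (W : Fin 4 → ℂ) (κ : Fin 4),
      ∑ μ, ((K.l μ : ℝ) : ℂ) * W μ = 0 ∧ W κ ≠ 0 := by
    by_cases h0 : K.l 0 = 0
    · exact ⟨Pi.single 0 1, 0, by simp [Fin.sum_univ_four, h0], by simp⟩
    · refine ⟨![-(K.l 1), K.l 0, 0, 0], 1, ?_, by simpa using h0⟩
      simp [Fin.sum_univ_four]; ring
  -- Transversality of W to the string removes the l_ρ p_κ/(pl) term of the obstruction.
  have hO : ∑ ρ, ((eta ρ : ℝ) : ℂ) * W ρ * K.obsF c p 2 ρ (.A 2 κ) = -Complex.I * W κ := by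
    have e : ∀ ρ, ((eta ρ : ℝ) : ℂ) * W ρ * K.obsF c p 2 ρ (.A 2 κ) =
        (if κ = ρ then -Complex.I * W ρ else 0) +
          Complex.I * ((low p κ / mdot p K.l : ℝ) : ℂ) * (((K.l ρ : ℝ) : ℂ) * W ρ) := by
      intro ρ
      have he : ((eta ρ : ℝ) : ℂ) * ((eta ρ : ℝ) : ℂ) = 1 := by exact_mod_cast eta_mul_self ρ
      rw [obsF_A hp (by decide) (show K.mB 2 ≠ 0 from hZ0) ρ κ hsymm, Model.inter, low, low]
      push_cast
      split_ifs with hk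
      · subst hk
        linear_combination (-Complex.I * W κ +
          Complex.I * (eta κ * p κ / mdot p K.l) * (K.l κ * W κ)) * he
      · push_cast
        linear_combination (Complex.I * (eta κ * p κ / mdot p K.l) * (K.l ρ * W ρ)) * he
    simp only [e, Finset.sum_add_distrib, ← Finset.mul_sum, hW]
    simp
  obtain ⟨e1, e2⟩ := cancelWW_axial hp h5 h6 h W 0 hW (by simp) κ
  simp only [hO, Pi.zero_apply, mul_zero, zero_mul, Finset.sum_const_zero, sub_zero] at e1 e2
  have r1 : (C.bt₃ * K.cosW - (C.b₁ * C.bt₂ + C.bt₁ * C.b₂)) * W κ = 0 := by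
    linear_combination e1 + C.bt₃ * K.cosW * W κ * Complex.I_sq
  have r2 : (C.bt₄ * K.cosW + (C.b₁ * C.bt₂ + C.bt₁ * C.b₂)) * W κ = 0 := by
    linear_combination e2 + C.bt₄ * K.cosW * W κ * Complex.I_sq
  have r1 := (mul_eq_zero.1 r1).resolve_right hκ
  have r2 := (mul_eq_zero.1 r2).resolve_right hκ
  refine ⟨sub_eq_zero.1 r1, ?_⟩
  have : (C.bt₄ + C.bt₃) * K.cosW = 0 := by linear_combination r1 + r2
  exact eq_neg_of_add_eq_zero_left ((mul_eq_zero.1 this).resolve_right hc)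

/-! ### Elimination and conclusion -/

theorem eq_zero_or_sq_eq_one {K : Model} (hK : K.Physical) {m : ℝ} {bt ct c0 : ℂ}
    (h1 : 2 * bt * ct = Complex.I * (K.mZ / (2 * K.cosW)) * c0)
    (h2 : 2 * bt * c0 = -(Complex.I / (2 * K.cosW * K.mZ)) * ct)
    (h3 : ct = Complex.I * (2 * m) * bt) :
    (m : ℂ) * (bt * ((4 * K.cosW * bt) ^ 2 - 1)) = 0 := by
  have hZ : (K.mZ : ℂ) ≠ 0 := by exact_mod_cast (hK.mW_pos.trans hK.mW_lt_mZ).ne'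
  have hW : (K.mW : ℂ) ≠ 0 := by exact_mod_cast hK.mW_pos.ne'
  have hc : (K.cosW : ℂ) ≠ 0 := by
    rw [Model.cosW]; push_cast; exact div_ne_zero hW hZ
  have hI := Complex.I_ne_zero
  have e1 : c0 * K.mZ = 8 * K.cosW * m * bt ^ 2 := by
    subst h3
    field_simp at h1
    linear_combination -h1
  have e2 : 2 * K.cosW * K.mZ * (bt * c0) = m * bt := by
    subst h3
    field_simp at h2
    linear_combination h2 - (m * bt) * Complex.I_sq
  linear_combination 2 * K.cosW * bt * (-e1) + e2

/-- The axial coupling of the electron to the `Z` boson does not vanish. -/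
theorem axial_ne_zero {mE mN b bt x y : ℂ} (hE : mE ≠ 0) (hEN : mE + mN ≠ 0)
    (hW : b ≠ 0 ∨ bt ≠ 0) (hdeg : mE = mN → x ≠ 0)
    (hy : mN * (y * (y ^ 2 - 1)) = 0)
    (h1 : bt * (mE * x + mN * y) = (mE - mN) * b)
    (h2 : b * (mE * x - mN * y) = (mE + mN) * bt) : x ≠ 0 := by
  rintro rfl
  have hne : mE - mN ≠ 0 := fun h => hdeg (sub_eq_zero.1 h) rfl
  have hb : b = 0 → bt = 0 := fun h => by
    subst h
    exact (mul_eq_zero.1 (show (mE + mN) * bt = 0 by linear_combination -h2)).resolve_left hEN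
  have hbt : bt = 0 → b = 0 := fun h => by
    subst h
    exact (mul_eq_zero.1 (show (mE - mN) * b = 0 by linear_combination -h1)).resolve_left hne
  have hb0 : b ≠ 0 := fun h => hW.elim (fun h' => h' h) (fun h' => h' (hb h))
  have hbt0 : bt ≠ 0 := fun h => hb0 (hbt h)
  -- Eliminating between the two relations at x = 0; as y² = 1 will follow, the bracket reduces to
  -- `mE ^ 2`, a contradiction.
  have key : (b * bt) * (mE ^ 2 - mN ^ 2 + (mN * y) ^ 2) = 0 := by
    linear_combination (-(mE + mN) * bt) * h1 - bt * mN * y * h2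
  have key := (mul_eq_zero.1 key).resolve_left (mul_ne_zero hb0 hbt0)
  have hu : mN * y ≠ 0 := fun h => hb0 <| (mul_eq_zero.1
    (show (mE - mN) * b = 0 by linear_combination -h1 + bt * h)).resolve_left hne
  have hy1 : y ^ 2 - 1 = 0 := (mul_eq_zero.1 (show (mN * y) * (y ^ 2 - 1) = 0 by
    linear_combination hy)).resolve_left hu
  exact pow_ne_zero 2 hE (by linear_combination key - mN ^ 2 * hy1)

end StringLocal

end

theorem mainTheorem2 (K : StringLocal.Model) (hK : K.Physical)
    (C : StringLocal.Couplings) (hC : C.Admissible)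
    (hW : C.b₁ ≠ 0 ∨ C.bt₁ ≠ 0) (hdeg : K.mE = K.mN → C.bt₃ ≠ 0)
    (h₁ : C.FirstOrder K)
    (c : StringLocal.Renorm)
    (hZe : StringLocal.CancelZEscort K C c 0 ∧ StringLocal.CancelZHiggs K C c 0)
    (hZν : StringLocal.CancelZEscort K C c 1 ∧ StringLocal.CancelZHiggs K C c 1)
    (hWW : StringLocal.CancelWW K C c 0 ∧ StringLocal.CancelWW K C c 1)
    (hWφ : StringLocal.CancelWEscort K C c) :
    ∃ ε₁ : ℂ, (ε₁ = 1 ∨ ε₁ = -1) ∧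
      C.bt₃ = ε₁ * (1 / (4 * (K.cosW : ℂ))) ∧
      C.bt₁ = ε₁ * C.b₁ ∧ C.bt₂ = ε₁ * C.b₂ ∧
      (∀ W : Fin 4 → Fin 4 → ℂ, (∀ μ, W 2 μ = 0 ∧ W 3 μ = 0) →
        C.S1F W 0 0 0 1 = ∑ μ, (C.b₁ * StringLocal.minus (fun a => W a μ)) •
          (StringLocal.gam μ * (1 + ε₁ • StringLocal.gam5)) ∧
        C.S1F W 0 0 1 0 = ∑ μ, (C.b₂ * StringLocal.plus (fun a => W a μ)) •
          (StringLocal.gam μ * (1 + ε₁ • StringLocal.gam5))) ∧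
      C.b₁ ^ 2 = 1 / 8 ∧ C.bt₁ ^ 2 = 1 / 8 := by
  obtain ⟨p, hp⟩ := hK.exists_generic
  obtain ⟨c1, ct1, c3, ct3, c4, ct4, bt5⟩ := h₁.couplings hK.mE_pos.ne'
  have hZ : (K.mZ : ℂ) ≠ 0 := by exact_mod_cast (hK.mW_pos.trans hK.mW_lt_mZ).ne'
  have hmW : (K.mW : ℂ) ≠ 0 := by exact_mod_cast hK.mW_pos.ne'
  have hc : (K.cosW : ℂ) ≠ 0 := by
    rw [StringLocal.Model.cosW]; push_cast; exact div_ne_zero hmW hZ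
  have hE : (K.mE : ℂ) ≠ 0 := by exact_mod_cast hK.mE_pos.ne'
  have hEN : (K.mE : ℂ) + K.mN ≠ 0 := by
    exact_mod_cast (add_pos_of_pos_of_nonneg hK.mE_pos hK.mN_nonneg).ne'
  have hb2 : C.b₂ = C.b₁ := by rw [hC.b₂_eq, hC.b₁_real]
  have hbt2 : C.bt₂ = C.bt₁ := by rw [hC.bt₂_eq, hC.bt₁_real]
  obtain ⟨ze1, ze2⟩ := StringLocal.cancelZ_relations hK hp 0 (cs := C.c₃) (ct := C.ct₃)
    (c0 := C.c₀) (ct0 := C.ct₀) (bt := C.bt₃)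
    (fun ω => by simp [StringLocal.Couplings.axial, StringLocal.ofZ])
    (fun _ _ => rfl) (fun _ _ => rfl) c3 hZe
  obtain ⟨zn1, zn2⟩ := StringLocal.cancelZ_relations hK hp 1 (cs := C.c₄) (ct := C.ct₄)
    (c0 := C.c₅) (ct0 := C.ct₅) (bt := C.bt₄)
    (fun ω => by simp [StringLocal.Couplings.axial, StringLocal.ofZ])
    (fun _ _ => rfl) (fun _ _ => rfl) c4 hZν
  have he := StringLocal.eq_zero_or_sq_eq_one hK ze1 ze2 ct3
  have hn := StringLocal.eq_zero_or_sq_eq_one hK zn1 zn2 ct4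
  obtain ⟨w1, w2⟩ := StringLocal.cancelWEscort_relations hK hp c3 c4 hWφ
  have v1 : C.bt₁ * (K.mE * (4 * K.cosW * C.bt₃) + K.mN * (4 * K.cosW * C.bt₄)) =
      (K.mE - K.mN) * C.b₁ := by
    rw [ct3, ct4, c1] at w1
    field_simp at w1
    linear_combination w1
  have v2 : C.b₁ * (K.mE * (4 * K.cosW * C.bt₃) - K.mN * (4 * K.cosW * C.bt₄)) =
      (K.mE + K.mN) * C.bt₁ := by
    rw [ct3, ct4, ct1] at w2
    field_simp at w2
    linear_combination w2
  -- This must precede the use of `hWW`: with b̃₃ = 0 the added distribution would be unconstrained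
  -- by the electron relation.
  have hx : 4 * K.cosW * C.bt₃ ≠ 0 :=
    StringLocal.axial_ne_zero hE hEN hW
      (fun h => mul_ne_zero (mul_ne_zero (by norm_num : (4 : ℂ) ≠ 0) hc) (hdeg (by exact_mod_cast h)))
      (by linear_combination 4 * K.cosW * hn) v1 v2
  have hbt3 : C.bt₃ ≠ 0 := right_ne_zero_of_mul hx
  obtain ⟨r1, r2⟩ := StringLocal.cancelWW_relations hK hp bt5 hC.bt₆_zero hWW hbt3
  set ε : ℂ := 4 * K.cosW * C.bt₃ with hε
  have hε2 : ε ^ 2 - 1 = 0 :=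
    (mul_eq_zero.1 ((mul_eq_zero.1 he).resolve_left hE)).resolve_left hbt3
  -- With b̃₄ = -b̃₃, both lepton masses in `v2` multiply the same ε, and m_e + m_ν cancels.
  have hb : C.bt₁ = ε * C.b₁ := by
    rw [r2] at v2
    refine mul_left_cancel₀ hEN ?_
    linear_combination -v2
  rw [hb2, hbt2, hb] at r1
  -- Now `r1` reads ε/4 = 2εb₁².
  have hb8 : C.b₁ ^ 2 = 1 / 8 := by
    refine mul_left_cancel₀ hx ?_
    linear_combination -r1 / 2 - hε / 8
  refine ⟨ε, ?_, ?_, hb, by rw [hb2, hbt2, hb], fun W _ => ?_, hb8, ?_⟩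
  · exact sq_eq_one_iff.1 (sub_eq_zero.1 hε2)
  · rw [hε]; field_simp
  · have hbt2' : C.bt₂ = ε * C.b₂ := by rw [hb2, hbt2, hb]
    constructor
    · simp [StringLocal.Couplings.S1F, StringLocal.Couplings.vec, StringLocal.Couplings.axial,
        StringLocal.Couplings.scalar, StringLocal.Couplings.pseudo, StringLocal.minus, hb,
        mul_add, smul_smul]
      refine Finset.sum_congr rfl fun μ _ => ?_
      module
    · simp [StringLocal.Couplings.S1F, StringLocal.Couplings.vec, StringLocal.Couplings.axial,
        StringLocal.Couplings.scalar, StringLocal.Couplings.pseudo, StringLocal.plus, hbt2',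
        mul_add, smul_smul]
      refine Finset.sum_congr rfl fun μ _ => ?_
      module
  · rw [hb]; linear_combination C.b₁ ^ 2 * hε2 + hb8
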